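/- All vector spaces are over $\mathbb{C}$, and for a vector space $U$ write $U((x))$ for the formal Laurent series in $x$ with coefficients in $U$ and finitely many negative powers, and $U((x_1,x_2))=U[[x_1,x_2]][x_1^{-1},x_2^{-1}]$. Expressions $(x-y)^n$, $n\in\mathbb{Z}$, are expanded in nonnegative powers of $y$, and $\delta(x)=\sum_{n\in\mathbb{Z}}x^n$. A *weak quantum vertex algebra* is a vector space $V$ with a linear map $Y(\cdot,x):V\to(\mathrm{End}\,V)[[x,x^{-1}]]$ and a vector $\mathbf 1\in V$ such that $Y(u,x)v\in V((x))$, $Y(\mathbf 1,x)v=v$, $Y(u,x)\mathbf 1\in V[[x]]$ and $\lim_{x\to0}Y(u,x)\mathbf 1=u$ for all $u,v\in V$, and such that for all $u,v\in V$ there are finitely many $u^{(i)},v^{(i)}\in V$, $f_i(x)\in\mathbb{C}((x))$ with $$x_0^{-1}\delta\Big(\frac{x_1-x_2}{x_0}\Big)Y(u,x_1)Y(v,x_2)-x_0^{-1}\delta\Big(\frac{x_2-x_1}{-x_0}\Big)\sum_i f_i(x_2-x_1)Y(v^{(i)},x_2)Y(u^{(i)},x_1)=x_2^{-1}\delta\Big(\frac{x_1-x_0}{x_2}\Big)Y(Y(u,x_0)v,x_2).$$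 It is said to have *a constant map $\mathcal S$* if there is a linear map $\mathcal S:V\otimes V\to V\otimes V$ such that for all $u,v\in V$ this identity holds with $\mathcal S(v\otimes u)=\sum_i v^{(i)}\otimes u^{(i)}$ and all $f_i=1$. Put $\mathcal D v=\lim_{x\to0}\frac{d}{dx}Y(v,x)\mathbf 1$; the *opposite algebra* is $V^o=(V,Y^o,\mathbf 1)$ with $Y^o(u,x)v=e^{x\mathcal D}Y(v,-x)u$. Let $\phi(x,z)\in\mathbb{C}((x))[[z]]$ be one of $x+z$ and $\frac{x}{1+zx}$ (expanded in nonnegative powers of $z$). A *$\phi$-coordinated $V$-module* is a vector space $W$ with a linear map $Y_W(\cdot,x):V\to(\mathrm{End}\,W)[[x,x^{-1}]]$ such that $Y_W(v,x)w\in W((x))$ for all $v\in V$, $w\in W$, $Y_W(\mathbf 1,x)=1_W$, and for all $u,v\in V$ there is $k\in\mathbb{N}$ with $(x_1-x_2)^kY_W(u,x_1)Y_W(v,x_2)\in\mathrm{Hom}(W,W((x_1,x_2)))$ and $$\big((x_1-x_2)^kY_W(u,x_1)Y_W(v,x_2)\big)\big|_{x_1=\phi(x_2,z)}=(\phi(x_2,z)-x_2)^kY_W(Y(u,z)v,x_2).$$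 A *$V$-module* is a $\phi$-coordinated $V$-module with $\phi(x,z)=x+z$. **Theorem.** Let $V$ be a weak quantum vertex algebra with a constant map $\mathcal S$, and let $(W,Y_W)$ be a $V$-module. Define $Y_W^*(\cdot,x):V\to(\mathrm{End}\,W^*)[[x,x^{-1}]]$ by $\langle Y_W^*(v,x)\alpha,w\rangle=\langle\alpha,Y_W(v,x^{-1})w\rangle$ for $v\in V$, $\alpha\in W^*$, $w\in W$, and let $D(W)$ be the subspace of all $\alpha\in W^*$ with $Y_W^*(v,x)\alpha\in W^*((x))$ for every $v\in V$. Then $$Y_W^*(v,x)\alpha\in D(W)((x))\quad\text{for all }v\in V,\ \alpha\in D(W).$$ Furthermore, $V^o$ is a weak quantum vertex algebra, and $(D(W),Y_W^*)$ is a $\phi$-coordinated $V^o$-module with $\phi(x,z)=\frac{x}{1+zx}$. -/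

import Mathlib

open scoped TensorProduct

noncomputable section

/-!
Formal series in `U[[x, x⁻¹]]` are functions `ℤ → U`; the value at `n` is the coefficient of `x ^ n`.
A vertex operator map `Y(·, x) : V → (End W)[[x, x⁻¹]]` is a linear map
`Y : V →ₗ[ℂ] (ℤ → Module.End ℂ W)`; so `Y v n w` is the coefficient of `x ^ n` in `Y(v, x) w`.
All infinite sums below (`∑ᶠ`) have finitely many nonzero terms on the objects considered.
-/

namespace WQVA

/-- `f ∈ U((x))`: only finitely many negative powers of `x` occur. -/
def IsLaurent {U : Type*} [Zero U] (f : ℤ → U) : Prop :=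
  ∃ N : ℤ, ∀ n < N, f n = 0

/-- `A ∈ U((x₁, x₂)) = U[[x₁, x₂]][x₁⁻¹, x₂⁻¹]`; `A m n` is the coefficient of `x₁ ^ m * x₂ ^ n`. -/
def IsLaurent₂ {U : Type*} [Zero U] (A : ℤ → ℤ → U) : Prop :=
  ∃ N : ℤ, ∀ m n : ℤ, (m < N ∨ n < N) → A m n = 0

/-- The coefficient of `x ^ (n - i) * y ^ i` in `(x - y) ^ n`, expanded in nonnegative powers
of `y`, for an arbitrary integer `n`. -/
def subPowCoeff (n : ℤ) (i : ℕ) : ℂ :=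
  (-1) ^ i * ((Ring.choose n i : ℤ) : ℂ)

section Algebra

variable {V : Type*} [AddCommGroup V] [Module ℂ V]

/-- The coefficient of `x₀ ^ a * x₁ ^ b * x₂ ^ c` in
`x₀⁻¹ δ((x₁ - x₂) / x₀) Y(u, x₁) Y(v, x₂) w`,
where `x₀⁻¹ δ((x₁ - x₂) / x₀) = ∑ₙ x₀ ^ (-n-1) * (x₁ - x₂) ^ n` (so `n = -a-1`). -/
def jacobiLeft₁ (Y : V →ₗ[ℂ] (ℤ → Module.End ℂ V)) (u v w : V) (a b c : ℤ) : V :=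
  ∑ᶠ i : ℕ, subPowCoeff (-a - 1) i • Y u (b - (-a - 1 - i)) (Y v (c - i) w)

/-- The coefficient of `x₀ ^ a * x₁ ^ b * x₂ ^ c` in
`x₀⁻¹ δ((x₂ - x₁) / (-x₀)) f(x₂ - x₁) Y(v, x₂) Y(u, x₁) w`, where
`x₀⁻¹ δ((x₂ - x₁) / (-x₀)) = ∑ₙ (-1) ^ n * x₀ ^ (-n-1) * (x₂ - x₁) ^ n` (so `n = -a-1`).
The index `m` runs over the terms of `f(x) = ∑ₘ fₘ x ^ m`. -/
def jacobiLeft₂ (Y : V →ₗ[ℂ] (ℤ → Module.End ℂ V)) (f : LaurentSeries ℂ) (u v w : V)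
    (a b c : ℤ) : V :=
  (-1 : ℂ) ^ (-a - 1) • ∑ᶠ p : ℤ × ℕ,
    (f.coeff p.1 * subPowCoeff (-a - 1 + p.1) p.2) •
      Y v (c - (-a - 1 + p.1 - p.2)) (Y u (b - p.2) w)

/-- The coefficient of `x₀ ^ a * x₁ ^ b * x₂ ^ c` in
`x₂⁻¹ δ((x₁ - x₀) / x₂) Y(Y(u, x₀) v, x₂) w`, where
`x₂⁻¹ δ((x₁ - x₀) / x₂) = ∑ₙ x₂ ^ (-n-1) * (x₁ - x₀) ^ n` (so `n = b + i`). -/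
def jacobiRight (Y : V →ₗ[ℂ] (ℤ → Module.End ℂ V)) (u v w : V) (a b c : ℤ) : V :=
  ∑ᶠ i : ℕ, subPowCoeff (b + i) i • Y (Y u (a - i) v) (c + (b + i) + 1) w

/-- The `S`-Jacobi identity for `u, v`, with vectors `u⁽ⁱ⁾ = u' i`, `v⁽ⁱ⁾ = v' i` and
series `fᵢ(x) = f i`. -/
def SJacobi (Y : V →ₗ[ℂ] (ℤ → Module.End ℂ V)) (u v : V) {r : ℕ} (u' v' : Fin r → V)
    (f : Fin r → LaurentSeries ℂ) : Prop :=
  ∀ (w : V) (a b c : ℤ),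
    jacobiLeft₁ Y u v w a b c - ∑ i, jacobiLeft₂ Y (f i) (u' i) (v' i) w a b c
      = jacobiRight Y u v w a b c

/-- `(V, Y, 𝟏)` is a weak quantum vertex algebra. -/
structure IsWeakQuantumVertexAlgebra (Y : V →ₗ[ℂ] (ℤ → Module.End ℂ V)) (one : V) : Prop where
  truncation : ∀ u v : V, IsLaurent fun n => Y u n v
  /-- `Y(𝟏, x) v = v` -/
  vacuum : Y one = Pi.single 0 1
  /-- `Y(u, x) 𝟏 ∈ V[[x]]` -/
  creation : ∀ (u : V), ∀ n < 0, Y u n one = 0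
  /-- `lim_{x → 0} Y(u, x) 𝟏 = u` -/
  creation_limit : ∀ u : V, Y u 0 one = u
  jacobi : ∀ u v : V, ∃ (r : ℕ) (u' v' : Fin r → V) (f : Fin r → LaurentSeries ℂ),
    SJacobi Y u v u' v' f

/-- There is a linear map `S : V ⊗ V → V ⊗ V`, not depending on `x`, such that the `S`-Jacobi
identity holds with `S(v ⊗ u) = ∑ᵢ v⁽ⁱ⁾ ⊗ u⁽ⁱ⁾` and `fᵢ(x) = 1`. -/
def HasConstantS (Y : V →ₗ[ℂ] (ℤ → Module.End ℂ V)) : Prop :=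
  ∃ S : V ⊗[ℂ] V →ₗ[ℂ] V ⊗[ℂ] V, ∀ u v : V, ∃ (r : ℕ) (u' v' : Fin r → V),
    S (v ⊗ₜ[ℂ] u) = ∑ i, v' i ⊗ₜ[ℂ] u' i ∧ SJacobi Y u v u' v' (fun _ => 1)

/-- The operator `𝒟 v = lim_{x → 0} (d/dx) Y(v, x) 𝟏`. -/
def derivOp (Y : V →ₗ[ℂ] (ℤ → Module.End ℂ V)) (one : V) : Module.End ℂ V where
  toFun v := Y v 1 one
  map_add' u v := by simp
  map_smul' c v := by simp

/-- The `i`-th term of the coefficient of `x ^ n` in `exp(x 𝒟) Y(v, -x) u`. -/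
def oppositeTerm (Y : V →ₗ[ℂ] (ℤ → Module.End ℂ V)) (one : V) (u v : V) (n : ℤ) (i : ℕ) : V :=
  ((i.factorial : ℂ)⁻¹ * (-1 : ℂ) ^ (n - i)) • (derivOp Y one ^ i) (Y v (n - i) u)

theorem oppositeTerm_finite {Y : V →ₗ[ℂ] (ℤ → Module.End ℂ V)}
    (hY : ∀ u v : V, IsLaurent fun n => Y u n v) (one u v : V) (n : ℤ) :
    (Function.support (oppositeTerm Y one u v n)).Finite := by
  obtain ⟨N, hN⟩ := hY v u
  refine (Set.finite_Iic (n - N).toNat).subset fun i hi => ?_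
  by_contra h
  simp only [Set.mem_Iic, not_le] at h
  apply hi
  have : Y v (n - i) u = 0 := hN _ (by omega)
  simp [oppositeTerm, this]

/-- The vertex operator map of the opposite algebra: `Yᵒ(u, x) v = exp(x 𝒟) Y(v, -x) u`. -/
def oppositeY (Y : V →ₗ[ℂ] (ℤ → Module.End ℂ V)) (one : V)
    (hY : ∀ u v : V, IsLaurent fun n => Y u n v) : V →ₗ[ℂ] (ℤ → Module.End ℂ V) where
  toFun u n :=
    { toFun := fun v => ∑ᶠ i : ℕ, oppositeTerm Y one u v n i
      map_add' := fun v v' => by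
        rw [← finsum_add_distrib (oppositeTerm_finite hY one u v n)
          (oppositeTerm_finite hY one u v' n)]
        exact finsum_congr fun i => by simp [oppositeTerm]
      map_smul' := fun c v => by
        rw [RingHom.id_apply, smul_finsum' c (oppositeTerm_finite hY one u v n)]
        exact finsum_congr fun i => by simp [oppositeTerm, smul_comm c] }
  map_add' u u' := by
    ext n v
    change ∑ᶠ i : ℕ, oppositeTerm Y one (u + u') v n i =
      ∑ᶠ i : ℕ, oppositeTerm Y one u v n i + ∑ᶠ i : ℕ, oppositeTerm Y one u' v n i
    rw [← finsum_add_distrib (oppositeTerm_finite hY one u v n)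
      (oppositeTerm_finite hY one u' v n)]
    exact finsum_congr fun i => by simp [oppositeTerm]
  map_smul' c u := by
    ext n v
    change ∑ᶠ i : ℕ, oppositeTerm Y one (c • u) v n i = c • ∑ᶠ i : ℕ, oppositeTerm Y one u v n i
    rw [smul_finsum' c (oppositeTerm_finite hY one u v n)]
    exact finsum_congr fun i => by simp [oppositeTerm, smul_comm c]

end Algebra

section Coordinates

/-- The variable `x` of `ℂ((x))`, viewed in `ℂ((x))[[z]]`. -/
def varX : PowerSeries (LaurentSeries ℂ) := PowerSeries.C (HahnSeries.single 1 1)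

/-- The variable `z` of `ℂ((x))[[z]]`. -/
def varZ : PowerSeries (LaurentSeries ℂ) := PowerSeries.X

/-- `φ(x, z) = x + z`. -/
def phiAdd : PowerSeries (LaurentSeries ℂ) := varX + varZ

/-- `φ(x, z) = x / (1 + z x)`, expanded in nonnegative powers of `z`. -/
def phiStar : PowerSeries (LaurentSeries ℂ) := varX * (1 + varZ * varX)⁻¹

/-- The integer powers `φ(x, z) ^ m` of a `φ ∈ ℂ((x))[[z]]` with `φ(x, 0) ≠ 0`. -/
def phiPow (φ : PowerSeries (LaurentSeries ℂ)) : ℤ → PowerSeries (LaurentSeries ℂ)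
  | Int.ofNat m => φ ^ m
  | Int.negSucc m => φ⁻¹ ^ (m + 1)

/-- The coefficient of `z ^ j * x ^ q` (for `j q : ℤ`) in an element of `ℂ((x))[[z]]`. -/
def zxCoeff (F : PowerSeries (LaurentSeries ℂ)) (j q : ℤ) : ℂ :=
  if 0 ≤ j then (PowerSeries.coeff j.toNat F).coeff q else 0

end Coordinates

section Modules

variable {V : Type*} [AddCommGroup V] [Module ℂ V] {W : Type*} [AddCommGroup W] [Module ℂ W]

/-- The coefficient of `x₁ ^ m * x₂ ^ n` in `(x₁ - x₂) ^ k Y_W(u, x₁) Y_W(v, x₂) w`. -/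
def mulPowCoeff (YW : V →ₗ[ℂ] (ℤ → Module.End ℂ W)) (k : ℕ) (u v : V) (w : W) (m n : ℤ) : W :=
  ∑ i ∈ Finset.range (k + 1),
    ((-1 : ℂ) ^ i * (k.choose i : ℂ)) • YW u (m - (k - i)) (YW v (n - i) w)

/-- The coefficient of `z ^ j * x₂ ^ c` in `A(x₁, x₂)|_{x₁ = φ(x₂, z)}`, for
`A(x₁, x₂) ∈ W((x₁, x₂))` and `φ ∈ ℂ((x))[[z]]` with `φ(x, 0) = x`. -/
def substCoeff (φ : PowerSeries (LaurentSeries ℂ)) (A : ℤ → ℤ → W) (j c : ℤ) : W :=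
  ∑ᶠ p : ℤ × ℤ, zxCoeff (phiPow φ p.1) j (c - p.2) • A p.1 p.2

/-- The coefficient of `z ^ j * x₂ ^ c` in `F(x₂, z) Y_W(Y(u, z) v, x₂) w`, for
`F ∈ ℂ((x))[[z]]`. -/
def iterateCoeff (Y : V →ₗ[ℂ] (ℤ → Module.End ℂ V)) (YW : V →ₗ[ℂ] (ℤ → Module.End ℂ W))
    (F : PowerSeries (LaurentSeries ℂ)) (u v : V) (w : W) (j c : ℤ) : W :=
  ∑ᶠ p : ℤ × ℤ, zxCoeff F p.1 p.2 • YW (Y u (j - p.1) v) (c - p.2) w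

/-- `(W, Y_W)` is a `φ`-coordinated module for the weak quantum vertex algebra `(V, Y, 𝟏)`. -/
structure IsPhiCoordinatedModule (φ : PowerSeries (LaurentSeries ℂ))
    (Y : V →ₗ[ℂ] (ℤ → Module.End ℂ V)) (one : V)
    (YW : V →ₗ[ℂ] (ℤ → Module.End ℂ W)) : Prop where
  truncation : ∀ (v : V) (w : W), IsLaurent fun n => YW v n w
  /-- `Y_W(𝟏, x) = 1_W` -/
  vacuum : YW one = Pi.single 0 1
  /-- For some `k`, `(x₁ - x₂)ᵏ Y_W(u, x₁) Y_W(v, x₂) ∈ Hom(W, W((x₁, x₂)))`, and its value at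
  `x₁ = φ(x₂, z)` is `(φ(x₂, z) - x₂)ᵏ Y_W(Y(u, z) v, x₂)`. -/
  assoc : ∀ u v : V, ∃ k : ℕ,
    (∀ w : W, IsLaurent₂ (mulPowCoeff YW k u v w)) ∧
    ∀ (w : W) (j c : ℤ),
      substCoeff φ (mulPowCoeff YW k u v w) j c = iterateCoeff Y YW ((φ - varX) ^ k) u v w j c

/-- A module for a weak quantum vertex algebra: the case `φ(x, z) = x + z`. -/
def IsModule (Y : V →ₗ[ℂ] (ℤ → Module.End ℂ V)) (one : V)
    (YW : V →ₗ[ℂ] (ℤ → Module.End ℂ W)) : Prop :=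
  IsPhiCoordinatedModule phiAdd Y one YW

/-- `Y_W^*(·, x) : V → (End W^*)[[x, x⁻¹]]`, `⟨Y_W^*(v, x) α, w⟩ = ⟨α, Y_W(v, x⁻¹) w⟩`. -/
def dualY (YW : V →ₗ[ℂ] (ℤ → Module.End ℂ W)) :
    V →ₗ[ℂ] (ℤ → Module.End ℂ (Module.Dual ℂ W)) where
  toFun v n := Module.Dual.transpose (R := ℂ) (YW v (-n))
  map_add' u v := by ext; simp [Module.Dual.transpose_apply]
  map_smul' c v := by ext; simp [Module.Dual.transpose_apply]

/-- `D(W)`: the subspace of all `α ∈ W^*` with `Y_W^*(v, x) α ∈ W^*((x))` for every `v`. -/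
def dualSpace (YW : V →ₗ[ℂ] (ℤ → Module.End ℂ W)) : Submodule ℂ (Module.Dual ℂ W) where
  carrier := {α | ∀ v : V, IsLaurent fun n => dualY YW v n α}
  zero_mem' v := ⟨0, fun n _ => by simp⟩
  add_mem' {α β} hα hβ v := by
    obtain ⟨M, hM⟩ := hα v
    obtain ⟨N, hN⟩ := hβ v
    refine ⟨min M N, fun n hn => ?_⟩
    have h₁ := hM n (lt_of_lt_of_le hn (min_le_left _ _))
    have h₂ := hN n (lt_of_lt_of_le hn (min_le_right _ _))
    simp only at h₁ h₂
    simp [h₁, h₂]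
  smul_mem' c α hα v := by
    obtain ⟨M, hM⟩ := hα v
    refine ⟨M, fun n hn => ?_⟩
    have h₁ := hM n hn
    simp only at h₁
    simp [h₁]

/-- Restriction of a vertex operator map to a subspace that is stable under all coefficients. -/
def restrictY (YW : V →ₗ[ℂ] (ℤ → Module.End ℂ W)) (U : Submodule ℂ W)
    (h : ∀ (v : V) (n : ℤ), ∀ w ∈ U, YW v n w ∈ U) : V →ₗ[ℂ] (ℤ → Module.End ℂ U) where
  toFun v n := (YW v n).restrict (h v n)
  map_add' u v := by ext; simp
  map_smul' c v := by ext; simp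

end Modules

end WQVA

end

open scoped TensorProduct

noncomputable section

namespace WQVA

/-! ### Binomial coefficients with integer entries -/

/-! Two facts about A ∈ U((x₁, x₂)) carry the proof: A is determined by its expansion A(x₂ + z, x₂)
(`eq_zero_of_taylorCoeff_eq_zero`), and A(x₁, x₁ + z) can be computed from that expansion
(`taylorCoeff_swap`). For constant 𝒮 the Jacobi identity amounts to weak associativity together with
the commutativity (x₁ - x₂)ᵏ Y(u, x₁) Y(v, x₂) = (x₁ - x₂)ᵏ ∑ Y(v⁽ⁱ⁾, x₂) Y(u⁽ⁱ⁾, x₁). Expanding at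
x₂ = x₁ + z instead of x₁ = x₂ + z replaces the iterate of Y(u, z)v by that of Yᵒ(v, z)u. Hence
commutativity on V, and on any module, follows from the skew symmetry Yᵒ(v, z)u = ∑ Y(v⁽ⁱ⁾, z)u⁽ⁱ⁾,
which is the Jacobi identity applied to 𝟏.

For the opposite algebra, Yᵒ(u, x₁) Yᵒ(v, x₂) w is exp(x₁𝒟) applied to Y(w, y₁) Y(v, y₂) u at y₁ =
-x₁, y₂ = x₂ - x₁. Its pole along y₂ = 0 is bounded in terms of u and v alone, so a power of x₁ - x₂
independent of w removes it; this is `exists_assoc_oppositeY`, and it gives associativity of Yᵒ.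
Since (Vᵒ)ᵒ = V, skew symmetry of Y gives that of Yᵒ, and the Jacobi identity follows.

For the dual, commutativity on W bounds both powers in ⟨α, (x₁ - x₂)ᵏ Y_W(u, x₁) Y_W(v, x₂) w⟩ from
above, uniformly in w (`exists_bound_mulPow_prodCoeff`). This gives stability of D(W) and the
Laurent condition. Finally x₁ = x₂ / (1 + z x₂) means x₁⁻¹ = x₂⁻¹ + z, and transposition reverses
products, so the required formula is the exchanged expansion on W read in inverse variables. -/

/-- The binomial coefficient `n.choose j` for integers `n` and `j`, equal to `0` for `j < 0`. -/
def ch (n j : ℤ) : ℂ := if 0 ≤ j then ((Ring.choose n j.toNat : ℤ) : ℂ) else 0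

theorem ch_natCast (n : ℤ) (j : ℕ) : ch n j = ((Ring.choose n j : ℤ) : ℂ) := by simp [ch]

theorem ch_of_neg (n : ℤ) {j : ℤ} (h : j < 0) : ch n j = 0 := by simp [ch, not_le.2 h]

@[simp] theorem ch_zero_right (n : ℤ) : ch n 0 = 1 := by simp [ch]

theorem ch_zero_left (j : ℤ) : ch 0 j = if j = 0 then 1 else 0 := by
  rcases lt_or_ge j 0 with h | h
  · rw [ch_of_neg _ h, if_neg h.ne]
  · lift j to ℕ using h
    rw [ch_natCast, Ring.choose_zero_ite]
    split_ifs <;> simp_all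

theorem ch_natCast_natCast (n j : ℕ) : ch n j = (n.choose j : ℂ) := by
  rw [ch_natCast, Ring.choose_natCast]; simp

theorem ch_succ (n j : ℤ) : ch (n + 1) j = ch n (j - 1) + ch n j := by
  rcases lt_or_ge j 0 with h | h
  · rw [ch_of_neg _ h, ch_of_neg _ h, ch_of_neg _ (by omega), add_zero]
  · lift j to ℕ using h
    cases j with
    | zero => rw [ch_of_neg n (j := ((0 : ℕ) : ℤ) - 1) (by simp)]; simp
    | succ j =>
      have : ((j + 1 : ℕ) : ℤ) - 1 = (j : ℕ) := by push_cast; ring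
      rw [this, ch_natCast, ch_natCast, ch_natCast, Ring.choose_succ_succ]
      push_cast; ring

theorem subPowCoeff_eq (n : ℤ) (i : ℕ) : subPowCoeff n i = (-1) ^ i * ch n i := by
  rw [subPowCoeff, ch_natCast]

/-- Vandermonde's identity. Any cutoff beyond `j` is allowed, so that sums with different natural
ranges can share one. -/
theorem sum_range_ch_mul_ch (a b j : ℤ) {M : ℕ} (hM : j < M) :
    ∑ i ∈ Finset.range M, ch a i * ch b (j - i) = ch (a + b) j := by
  rcases lt_or_ge j 0 with h | h
  · rw [ch_of_neg _ h]
    exact Finset.sum_eq_zero fun i _ => by rw [ch_of_neg b (by omega), mul_zero]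
  · lift j to ℕ using h
    rw [ch_natCast, Ring.add_choose_eq j (Commute.all a b),
      Finset.Nat.sum_antidiagonal_eq_sum_range_succ_mk]
    push_cast
    rw [← Finset.sum_subset (s₁ := Finset.range (j + 1))]
    · refine Finset.sum_congr rfl fun i hi => ?_
      rw [Finset.mem_range] at hi
      have : (j : ℤ) - i = ((j - i : ℕ) : ℤ) := by omega
      rw [this, ch_natCast, ch_natCast]
    · intro i hi
      simp only [Finset.mem_range] at *
      omega
    · intro i _ hi
      simp only [Finset.mem_range] at hi
      rw [ch_of_neg b (by omega), mul_zero]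

theorem ch_neg (n j : ℤ) : ch n j = (-1) ^ j * ch (j - n - 1) j := by
  rcases lt_or_ge j 0 with h | h
  · rw [ch_of_neg _ h, ch_of_neg _ h, mul_zero]
  · lift j to ℕ using h
    have := Ring.choose_neg' (-n) j
    rw [neg_neg] at this
    rw [ch_natCast, ch_natCast, this, Ring.multichoose_eq, show -n + (j : ℤ) - 1 = j - n - 1 by ring]
    rcases Nat.even_or_odd j with h | h <;>
      simp [h.neg_one_pow, Int.negOnePow_even, Int.negOnePow_odd, h, Units.smul_def]

theorem ch_symm {n : ℤ} (hn : 0 ≤ n) (j : ℤ) : ch n (n - j) = ch n j := by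
  lift n to ℕ using hn
  rcases lt_or_ge j 0 with h | h
  · rw [ch_of_neg _ h]
    have : (n : ℤ) - j = ((n + (-j).toNat : ℕ) : ℤ) := by omega
    rw [this, ch_natCast_natCast, Nat.choose_eq_zero_of_lt (by omega), Nat.cast_zero]
  · lift j to ℕ using h
    rcases lt_or_ge n j with h | h
    · rw [ch_of_neg _ (by omega), ch_natCast_natCast, Nat.choose_eq_zero_of_lt h, Nat.cast_zero]
    · rw [← Nat.cast_sub h, ch_natCast_natCast, ch_natCast_natCast, Nat.choose_symm h]

theorem ch_eq_zero_of_lt {n j : ℤ} (hn : 0 ≤ n) (h : n < j) : ch n j = 0 := by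
  rw [← ch_symm hn, ch_of_neg _ (by omega)]

theorem neg_one_zpow_mul_self (n : ℤ) : (-1 : ℂ) ^ n * (-1) ^ n = 1 := by
  rw [← mul_zpow]; simp

theorem neg_one_zpow_eq {m n : ℤ} (h : Even (m - n)) : (-1 : ℂ) ^ m = (-1) ^ n := by
  have h' : (-1 : ℂ) ^ (m - n) = 1 := h.neg_one_zpow
  rw [show m = (m - n) + n by ring, zpow_add₀ (by norm_num), h', one_mul]

theorem neg_one_zpow_add (m n : ℤ) : (-1 : ℂ) ^ (m + n) = (-1) ^ m * (-1) ^ n :=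
  zpow_add₀ (by norm_num) _ _

theorem neg_one_zpow_sub (m n : ℤ) : (-1 : ℂ) ^ (m - n) = (-1) ^ m * (-1) ^ n := by
  rw [← neg_one_zpow_add]
  exact neg_one_zpow_eq ⟨-n, by ring⟩

/-- The residue theorem for `t ^ (-r-1) * (t - 1) ^ N` in terms of binomial coefficients. -/
theorem ch_residue (N r : ℤ) :
    (-1) ^ (N - r) * (ch N (N - r) - ch N r) = ch (-r - 1) (-N - 1) := by
  have h₁ : (-1) ^ (N - r) * ch N (N - r) = ch (-r - 1) (N - r) := by
    rw [ch_neg N, ← mul_assoc, neg_one_zpow_mul_self, one_mul]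
    congr 1; ring
  have h₂ : (-1) ^ (N - r) * ch N r = (-1) ^ N * ch (r - N - 1) r := by
    rw [ch_neg N r, ← mul_assoc, neg_one_zpow_sub, mul_assoc ((-1) ^ N), neg_one_zpow_mul_self,
      mul_one]
  -- Only the expansion at infinity contributes for r < 0, only the one at 0 for N < 0 ≤ r; for N, r
  -- ≥ 0 the two agree, as (t - 1)ᴺ is a polynomial.
  rcases lt_or_ge r 0 with hr | hr
  · rw [ch_of_neg N hr, sub_zero, h₁, ← ch_symm (by omega)]
    congr 1; ring
  rcases lt_or_ge N 0 with hN | hN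
  · rw [ch_of_neg N (by omega), zero_sub, mul_neg, h₂, ch_neg (-r - 1),
      show -N - 1 - (-r - 1) - 1 = r - N - 1 by ring,
      ← ch_symm (n := r - N - 1) (by omega) r, show r - N - 1 - r = -N - 1 by ring, ← neg_mul]
    congr 1
    rw [neg_one_zpow_sub, ← neg_one_zpow_eq (m := N) (n := -N) ⟨N, by ring⟩]
    simp
  · rw [ch_symm hN, sub_self, mul_zero, ch_of_neg _ (by omega)]

/-- By Pascal's rule a forward difference in the upper entry lowers the lower entry by one; the sum
is a Q-fold difference up to sign. -/
theorem sum_range_alternating_choose_mul_ch (Q : ℕ) (x j : ℤ) :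
    ∑ n ∈ Finset.range (Q + 1), (-1 : ℂ) ^ n * (Q.choose n : ℂ) * ch (x + n) j =
      (-1) ^ Q * ch x (j - Q) := by
  have h : ∀ Q : ℕ, (fwdDiff (1 : ℤ))^[Q] (fun x => ch x j) = fun x => ch x (j - Q) := by
    intro Q
    induction Q with
    | zero => simp
    | succ Q ih =>
      rw [Function.iterate_succ_apply', ih]
      ext y
      rw [fwdDiff, ch_succ]
      push_cast
      rw [add_sub_cancel_right]; congr 1; ring
  have h' := fwdDiff_iter_eq_sum_shift (1 : ℤ) (fun x => ch x j) Q x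
  rw [h] at h'
  simp only at h'
  rw [h', Finset.mul_sum]
  refine Finset.sum_congr rfl fun n hn => ?_
  rw [Finset.mem_range] at hn
  have : (-1 : ℂ) ^ Q = (-1) ^ (Q - n) * (-1) ^ n := by rw [← pow_add]; congr 1; omega
  rw [zsmul_eq_mul, this]
  have h2 : (-1 : ℂ) ^ (Q - n) * (-1) ^ (Q - n) = 1 := by rw [← mul_pow]; simp
  push_cast
  simp only [mul_one, nsmul_eq_mul]
  linear_combination (-(-1 : ℂ) ^ n * (Q.choose n : ℂ) * ch (x + n) j) * h2

/-! ### Sums with finite support -/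

section Sums

variable {U : Type*} [AddCommGroup U]

theorem finsum_nat_eq_sum (f : ℕ → U) (M : ℕ) (h : ∀ i, M ≤ i → f i = 0) :
    ∑ᶠ i, f i = ∑ i ∈ Finset.range M, f i := by
  refine finsum_eq_sum_of_support_subset f fun i hi => ?_
  by_contra h'
  exact hi (h i (by simpa using h'))

theorem finsum_int_eq_sum (f : ℤ → U) (a b : ℤ) (h : ∀ i, i < a ∨ b < i → f i = 0) :
    ∑ᶠ i, f i = ∑ i ∈ Finset.Icc a b, f i := by
  refine finsum_eq_sum_of_support_subset f fun i hi => ?_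
  by_contra h'
  refine hi (h i ?_)
  simp only [Finset.coe_Icc, Set.mem_Icc, not_and, not_le] at h'
  by_contra! h''
  have := h' h''.1
  omega

theorem finsum_eq_finsum_of_injective {ι κ : Type*} (e : ι → κ) (he : Function.Injective e)
    (f : κ → U) (h : ∀ x, (∀ i, e i ≠ x) → f x = 0) : ∑ᶠ x, f x = ∑ᶠ i, f (e i) := by
  rw [← finsum_mem_range he, ← finsum_mem_univ, ← finsum_mem_inter_support]
  rw [← finsum_mem_inter_support (s := Set.range e)]
  refine finsum_mem_congr (Set.ext fun x => ?_) fun _ _ => rfl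
  simp only [Set.mem_inter_iff, Set.mem_univ, true_and, Function.mem_support, Set.mem_range]
  refine ⟨fun hx => ⟨?_, hx⟩, fun hx => hx.2⟩
  by_contra! h'
  exact hx (h x h')

end Sums

/-! ### Powers of `φ` -/

section Powers

theorem single_sum {ι : Type*} (a : ℤ) (s : Finset ι) (f : ι → ℂ) :
    HahnSeries.single a (∑ i ∈ s, f i) = ∑ i ∈ s, HahnSeries.single a (f i) :=
  map_sum (HahnSeries.single.linearMap (R := ℂ) a) f s

/-- The series `x ^ m * (1 + z * x ^ (-ε)) ^ (ε * m)`. -/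
def phiFamily (ε m : ℤ) : PowerSeries (LaurentSeries ℂ) :=
  PowerSeries.mk fun j => HahnSeries.single (m - ε * j) (ch (ε * m) j)

theorem phiFamily_zero (ε : ℤ) : phiFamily ε 0 = 1 := by
  ext1 j
  rw [phiFamily, PowerSeries.coeff_mk, PowerSeries.coeff_one, mul_zero, ch_zero_left]
  split_ifs with h h' h'
  · simp_all
  · simp_all
  · simp_all
  · simp

/-- Vandermonde again. Additivity of exponents reduces all integer powers of both coordinates, ε = 1
and ε = -1, to the case m = 1. -/
theorem phiFamily_mul (ε m n : ℤ) : phiFamily ε m * phiFamily ε n = phiFamily ε (m + n) := by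
  ext1 j
  simp only [phiFamily, PowerSeries.coeff_mk, PowerSeries.coeff_mul]
  rw [mul_add, ← sum_range_ch_mul_ch (ε * m) (ε * n) j (M := j + 1) (by simp),
    Finset.Nat.sum_antidiagonal_eq_sum_range_succ_mk, single_sum]
  refine Finset.sum_congr rfl fun i hi => ?_
  rw [Finset.mem_range] at hi
  have : ((j - i : ℕ) : ℤ) = j - i := by omega
  rw [HahnSeries.single_mul_single, this,
    show m - ε * i + (n - ε * (j - i)) = m + n - ε * j by ring]

theorem phiFamily_one_one : phiFamily 1 1 = phiAdd := by
  ext1 j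
  rw [phiFamily, PowerSeries.coeff_mk, phiAdd, varX, varZ, map_add, PowerSeries.coeff_C,
    PowerSeries.coeff_X]
  rcases j with _ | _ | j
  · simp
  · have := ch_natCast_natCast 1 1
    simp at this
    simp [this]
  · have : ch 1 ((j + 1 + 1 : ℕ) : ℤ) = 0 := ch_eq_zero_of_lt (by norm_num) (by push_cast; omega)
    simp only [mul_one, this]
    simp

/-- The equation defining x / (1 + zx) with the denominator cleared; the inverse of the series is
x⁻¹ + z. -/
theorem one_add_varZ_mul_varX : (1 + varZ * varX) * phiFamily (-1) 1 = varX := by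
  have h : (1 + varZ * varX : PowerSeries (LaurentSeries ℂ)) = varX * phiFamily (-1) (-1) := by
    ext1 j
    rw [varX, varZ, PowerSeries.coeff_C_mul, phiFamily, PowerSeries.coeff_mk,
      HahnSeries.single_mul_single, map_add, PowerSeries.coeff_one, mul_comm PowerSeries.X,
      PowerSeries.coeff_C_mul, PowerSeries.coeff_X]
    rcases j with _ | _ | j
    · simp
    · have := ch_natCast_natCast 1 1
      simp at this
      simp [this]
    · have : ch 1 ((j + 1 + 1 : ℕ) : ℤ) = 0 :=
        ch_eq_zero_of_lt (by norm_num) (by push_cast; omega)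
      rw [show (-1 : ℤ) * -1 = 1 by norm_num, this]
      simp
  rw [h, mul_assoc, phiFamily_mul]
  norm_num [phiFamily_zero]

theorem phiFamily_neg_one_one : phiFamily (-1) 1 = phiStar := by
  have h0 : PowerSeries.constantCoeff (1 + varZ * varX) ≠ 0 := by simp [varZ]
  rw [phiStar, PowerSeries.eq_mul_inv_iff_mul_eq h0, mul_comm]
  exact one_add_varZ_mul_varX

theorem phiFamily_pow (ε m : ℤ) (n : ℕ) : phiFamily ε m ^ n = phiFamily ε (m * n) := by
  induction n with
  | zero => simp [phiFamily_zero]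
  | succ n ih => rw [pow_succ, ih, phiFamily_mul]; congr 1; push_cast; ring

theorem phiFamily_inv (ε m : ℤ) : (phiFamily ε m)⁻¹ = phiFamily ε (-m) := by
  have h1 : phiFamily ε (-m) * phiFamily ε m = 1 := by
    rw [phiFamily_mul]; simp [phiFamily_zero]
  have h0 : PowerSeries.constantCoeff (phiFamily ε m) ≠ 0 := fun h => by
    have := congrArg PowerSeries.constantCoeff h1
    rw [map_mul, h, mul_zero] at this
    simp at this
  exact ((PowerSeries.eq_inv_iff_mul_eq_one h0).2 h1).symm

theorem phiPow_phiFamily (ε m : ℤ) : phiPow (phiFamily ε 1) m = phiFamily ε m := by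
  cases m with
  | ofNat m => rw [phiPow, phiFamily_pow]; congr 1; simp
  | negSucc m =>
    rw [phiPow, phiFamily_inv, phiFamily_pow]
    congr 1
    rw [Int.negSucc_eq]
    push_cast
    ring

theorem zxCoeff_phiFamily (ε m j q : ℤ) :
    zxCoeff (phiFamily ε m) j q = if q = m - ε * j then ch (ε * m) j else 0 := by
  rw [zxCoeff]
  rcases lt_or_ge j 0 with h | h
  · rw [if_neg (by omega), ch_of_neg _ h, ite_self]
  · lift j to ℕ using h
    rw [if_pos (by omega), phiFamily, PowerSeries.coeff_mk, HahnSeries.coeff_single]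
    simp only [Int.toNat_natCast]

/-- Since φ - x = -zxφ, the k-th power is (-1)ᵏ zᵏ x²ᵏ (1 + zx)⁻ᵏ. -/
theorem phiStar_sub_varX_pow (k : ℕ) (j q : ℤ) : zxCoeff ((phiStar - varX) ^ k) j q =
    if q = k + j then (-1) ^ k * ch (-k) (j - k) else 0 := by
  have h : phiStar - varX = -(varX * phiFamily (-1) 1 * PowerSeries.X) := by
    have := one_add_varZ_mul_varX
    rw [← phiFamily_neg_one_one]
    rw [varZ] at this
    linear_combination this
  have hk : (phiStar - varX) ^ k =
      PowerSeries.C (HahnSeries.single (k : ℤ) ((-1 : ℂ) ^ k)) * phiFamily (-1) k *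
        PowerSeries.X ^ k := by
    rw [h, neg_pow (varX * _ * _), mul_pow, mul_pow, phiFamily_pow, one_mul, varX, ← mul_assoc,
      ← mul_assoc]
    congr 2
    rw [← map_pow, HahnSeries.single_pow]
    rcases Nat.even_or_odd k with h | h <;>
      rw [h.neg_one_pow, h.neg_one_pow] <;> simp
  rw [hk, zxCoeff]
  rcases lt_or_ge j 0 with h | h
  · rw [if_neg (by omega), ch_of_neg _ (by omega), mul_zero, ite_self]
  · lift j to ℕ using h
    rw [if_pos (by omega), Int.toNat_natCast, PowerSeries.coeff_mul_X_pow']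
    split_ifs with h1 h2 h2
    all_goals try
      rw [PowerSeries.coeff_C_mul, phiFamily, PowerSeries.coeff_mk, HahnSeries.single_mul_single,
        HahnSeries.coeff_single, Nat.cast_sub h1]
    · rw [if_pos (by rw [h2]; ring), neg_one_mul]
    · rw [if_neg (by omega)]
    · rw [ch_of_neg _ (by omega), mul_zero]; simp
    · simp

end Powers

/-! ### Taylor coefficients of two-variable Laurent series along the diagonal -/

section TwoVariables

variable {U : Type*} [AddCommGroup U]

theorem IsLaurent₂.swap {A : ℤ → ℤ → U} (hA : IsLaurent₂ A) : IsLaurent₂ fun m n => A n m := by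
  obtain ⟨N, hN⟩ := hA
  exact ⟨N, fun m n h => hN n m h.symm⟩

theorem IsLaurent₂.add {A B : ℤ → ℤ → U} (hA : IsLaurent₂ A) (hB : IsLaurent₂ B) :
    IsLaurent₂ fun m n => A m n + B m n := by
  obtain ⟨N, hN⟩ := hA
  obtain ⟨N', hN'⟩ := hB
  refine ⟨min N N', fun m n h => ?_⟩
  simp only [lt_min_iff] at h
  simp only [hN m n (by omega), hN' m n (by omega), add_zero]

theorem IsLaurent₂.sum {ι : Type*} (s : Finset ι) {A : ι → ℤ → ℤ → U}
    (hA : ∀ i, IsLaurent₂ (A i)) : IsLaurent₂ fun m n => ∑ i ∈ s, A i m n := by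
  classical
  induction s using Finset.induction_on with
  | empty => exact ⟨0, fun m n _ => by simp⟩
  | insert i s hi ih =>
    simp only [Finset.sum_insert hi]
    exact (hA i).add ih

/-- In each total degree, the powers of `x₂` are bounded below. -/
def IsDiagTruncated (P : ℤ → ℤ → U) : Prop := ∀ d, ∃ N : ℤ, ∀ q < N, P (d - q) q = 0

theorem IsLaurent₂.isDiagTruncated {A : ℤ → ℤ → U} (hA : IsLaurent₂ A) : IsDiagTruncated A :=
  fun d => by
    obtain ⟨N, hN⟩ := hA
    exact ⟨N, fun q hq => hN _ _ (Or.inr hq)⟩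

theorem IsDiagTruncated.exists_bound {P : ℤ → ℤ → U} (hP : IsDiagTruncated P) (d q : ℤ) :
    ∃ M : ℕ, ∀ i : ℤ, M ≤ i → P (d - (q - i)) (q - i) = 0 := by
  obtain ⟨N, hN⟩ := hP d
  exact ⟨(q - N + 1).toNat, fun i hi => hN _ (by omega)⟩

variable [Module ℂ U]

/-- The coefficient of `z ^ j * x₂ ^ c` in `A(x₂ + z, x₂)`. -/
def taylorCoeff (A : ℤ → ℤ → U) (j c : ℤ) : U := ∑ᶠ m : ℤ, ch m j • A m (c + j - m)

theorem IsLaurent₂.smul {A : ℤ → ℤ → U} (hA : IsLaurent₂ A) (r : ℂ) :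
    IsLaurent₂ fun m n => r • A m n := by
  obtain ⟨N, hN⟩ := hA
  exact ⟨N, fun m n h => by simp only [hN m n h, smul_zero]⟩

theorem IsLaurent₂.finite_line {A : ℤ → ℤ → U} (hA : IsLaurent₂ A) (d : ℤ) (f : ℤ → ℂ) :
    (Function.support fun m => f m • A m (d - m)).Finite := by
  obtain ⟨N, hN⟩ := hA
  refine (Set.finite_Icc N (d - N)).subset fun m hm => ?_
  by_contra h
  rw [Set.mem_Icc, not_and_or] at h
  exact hm (by simp only [hN m (d - m) (by omega), smul_zero])

theorem finsum_line_eq_sum {A : ℤ → ℤ → U} {N : ℤ} (hN : ∀ m n : ℤ, (m < N ∨ n < N) → A m n = 0)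
    (d : ℤ) (f : ℤ → ℂ) :
    ∑ᶠ m : ℤ, f m • A m (d - m) = ∑ m ∈ Finset.Icc N (d - N), f m • A m (d - m) :=
  finsum_int_eq_sum _ _ _ fun m hm => by rw [hN m (d - m) (by omega), smul_zero]

theorem taylorCoeff_eq_sum {A : ℤ → ℤ → U} {N : ℤ} (hN : ∀ m n : ℤ, (m < N ∨ n < N) → A m n = 0)
    {j c d : ℤ} (hd : c + j = d) :
    taylorCoeff A j c = ∑ m ∈ Finset.Icc N (d - N), ch m j • A m (d - m) := by
  rw [taylorCoeff, hd, finsum_line_eq_sum hN]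

theorem taylorCoeff_of_neg (A : ℤ → ℤ → U) {j : ℤ} (hj : j < 0) (c : ℤ) :
    taylorCoeff A j c = 0 := by
  simp [taylorCoeff, ch_of_neg _ hj]

theorem taylorCoeff_smul (A : ℤ → ℤ → U) (r : ℂ) (j c : ℤ) :
    taylorCoeff (fun m n => r • A m n) j c = r • taylorCoeff A j c := by
  simp only [taylorCoeff, smul_finsum, smul_comm r]

theorem taylorCoeff_sub {A B : ℤ → ℤ → U} (hA : IsLaurent₂ A) (hB : IsLaurent₂ B) (j c : ℤ) :
    taylorCoeff (fun m n => A m n - B m n) j c = taylorCoeff A j c - taylorCoeff B j c := by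
  simp only [taylorCoeff, smul_sub]
  exact finsum_sub_distrib (hA.finite_line _ _) (hB.finite_line _ _)

theorem taylorCoeff_sum {ι : Type*} (s : Finset ι) {A : ι → ℤ → ℤ → U}
    (hA : ∀ i, IsLaurent₂ (A i)) (j c : ℤ) :
    taylorCoeff (fun m n => ∑ i ∈ s, A i m n) j c = ∑ i ∈ s, taylorCoeff (A i) j c := by
  simp only [taylorCoeff, Finset.smul_sum]
  exact finsum_sum_comm s _ fun i _ => (hA i).finite_line _ _

/-- The expansion respects total degree, and each total degree contains finitely many monomials, on
which the binomial system is triangular after a shift. -/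
theorem eq_zero_of_taylorCoeff_eq_zero {A : ℤ → ℤ → U} (hA : IsLaurent₂ A)
    (h : ∀ j c, taylorCoeff A j c = 0) (m n : ℤ) : A m n = 0 := by
  obtain ⟨N, hN⟩ := hA
  obtain ⟨d, hd⟩ : ∃ d, d = m + n := ⟨_, rfl⟩
  -- Vandermonde lets `ch m` be replaced by `ch (m - N)`, whose upper entry is nonnegative on the
  -- support and which therefore vanishes for m - N < t.
  have h1 : ∀ t : ℕ, ∑ m ∈ Finset.Icc N (d - N), ch (m - N) t • A m (d - m) = 0 := by
    intro t
    have h2 : ∀ m : ℤ, ch (m - N) t = ∑ i ∈ Finset.range (t + 1), ch (-N) i * ch m (t - i) := by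
      intro m
      rw [sum_range_ch_mul_ch _ _ _ (by simp)]; congr 1; ring
    simp only [h2, Finset.sum_smul]
    rw [Finset.sum_comm]
    refine Finset.sum_eq_zero fun i _ => ?_
    simp only [mul_smul]
    rw [← Finset.smul_sum, ← taylorCoeff_eq_sum hN (c := d - (t - i)) (by ring), h, smul_zero]
  -- Descending induction on the power of x₁, starting at d - N: the equation with t = m - N kills
  -- smaller powers, larger ones are known to vanish, and the remaining coefficient is 1.
  have h2 : ∀ r : ℕ, A (d - N - r) (N + r) = 0 := by
    intro r
    induction r using Nat.strong_induction_on with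
    | _ r ih =>
      by_cases hr : d - N - r < N
      · exact hN _ _ (Or.inl hr)
      · have h3 := h1 (d - N - r - N).toNat
        rw [Finset.sum_eq_single (d - N - r)] at h3
        · rw [Int.toNat_of_nonneg (by omega), ← ch_symm (by omega), sub_self, ch_zero_right,
            one_smul] at h3
          rw [← h3]; congr 1; ring
        · intro m hm hne
          rw [Finset.mem_Icc] at hm
          rcases lt_or_gt_of_ne hne with hlt | hlt
          · rw [ch_eq_zero_of_lt (by omega) (by omega), zero_smul]
          · have := ih (d - N - m).toNat (by omega)
            rw [Int.toNat_of_nonneg (by omega), show d - N - (d - N - m) = m by ring,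
              show N + (d - N - m) = d - m by ring] at this
            rw [this, smul_zero]
        · intro hm
          exact absurd (Finset.mem_Icc.2 ⟨by omega, by omega⟩) hm
  by_cases hn : n < N
  · exact hN _ _ (Or.inr hn)
  · have := h2 (n - N).toNat
    rw [Int.toNat_of_nonneg (by omega), show d - N - (n - N) = m by omega,
      show N + (n - N) = n by ring] at this
    exact this

theorem eq_of_taylorCoeff_eq {A B : ℤ → ℤ → U} (hA : IsLaurent₂ A) (hB : IsLaurent₂ B)
    (h : ∀ j c, taylorCoeff A j c = taylorCoeff B j c) (m n : ℤ) : A m n = B m n := by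
  refine sub_eq_zero.1 (eq_zero_of_taylorCoeff_eq_zero (A := fun m n => A m n - B m n) ?_ ?_ m n)
  · simpa [sub_eq_add_neg] using hA.add (hB.smul (-1))
  · intro j c
    rw [taylorCoeff_sub hA hB, h, sub_self]

/-- Exchanging the variables: the Taylor expansion of `A(x₂, x₁)` at `x₁ = x₂ + z`. -/
theorem taylorCoeff_swap {A : ℤ → ℤ → U} (hA : IsLaurent₂ A) (j c : ℤ) :
    taylorCoeff (fun m n => A n m) j c =
      ∑ᶠ l : ℕ, ((-1 : ℂ) ^ (j - l) * ch (c + l) l) • taylorCoeff A (j - l) (c + l) := by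
  obtain ⟨N, hN⟩ := hA
  rw [finsum_nat_eq_sum _ (j + 1).toNat fun l hl => by
    rw [taylorCoeff_of_neg _ (by omega), smul_zero]]
  have h1 : ∀ l : ℕ, taylorCoeff A (j - l) (c + l) =
      ∑ m ∈ Finset.Icc N (c + j - N), ch m (j - l) • A m (c + j - m) := fun l =>
    taylorCoeff_eq_sum hN (by ring)
  simp only [h1, Finset.smul_sum, smul_smul]
  rw [Finset.sum_comm, taylorCoeff, ← finsum_comp_equiv (Equiv.subLeft (c + j))]
  have h2 : ∀ m : ℤ, ch (Equiv.subLeft (c + j) m) j •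
      A (c + j - Equiv.subLeft (c + j) m) (Equiv.subLeft (c + j) m) =
      ch (c + j - m) j • A m (c + j - m) := fun m => by
    rw [Equiv.subLeft_apply, sub_sub_cancel]
  simp only [h2]
  rw [finsum_line_eq_sum hN (c + j) fun m => ch (c + j - m) j]
  refine Finset.sum_congr rfl fun m _ => ?_
  rw [← Finset.sum_smul]
  congr 1
  -- Negating the upper entries turns the scalar identity into Vandermonde for (-c - 1) + m.
  rw [ch_neg, show j - (c + j - m) - 1 = (-c - 1) + m by ring,
    ← sum_range_ch_mul_ch (M := (j + 1).toNat) _ _ _ (by omega), Finset.mul_sum]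
  refine Finset.sum_congr rfl fun l _ => ?_
  rw [ch_neg (-c - 1), show (l : ℤ) - (-c - 1) - 1 = c + l by ring, neg_one_zpow_sub]
  ring

/-! ### Multiplication by powers of `x₁ - x₂` -/

/-- The coefficient of `x₁ ^ p * x₂ ^ q` in `(x₁ - x₂) ^ n * P(x₁, x₂)`. -/
def mulPow (n : ℤ) (P : ℤ → ℤ → U) (p q : ℤ) : U :=
  ∑ᶠ i : ℕ, subPowCoeff n i • P (p - n + i) (q - i)

theorem mulPow_eq_sum {P : ℤ → ℤ → U} {n p q : ℤ} {M : ℕ}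
    (hM : ∀ i : ℤ, M ≤ i → P (p - n + i) (q - i) = 0) :
    mulPow n P p q = ∑ i ∈ Finset.range M, subPowCoeff n i • P (p - n + i) (q - i) :=
  finsum_nat_eq_sum _ _ fun i hi => by rw [hM i (by exact_mod_cast hi), smul_zero]

theorem mulPow_eq_finsum_int (n : ℤ) (P : ℤ → ℤ → U) (p q : ℤ) :
    mulPow n P p q = ∑ᶠ i : ℤ, ((-1 : ℂ) ^ i * ch n i) • P (p - n + i) (q - i) := by
  rw [mulPow, finsum_eq_finsum_of_injective (fun i : ℕ => (i : ℤ)) Nat.cast_injective]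
  · simp [subPowCoeff_eq]
  · intro i hi
    rw [ch_of_neg, mul_zero, zero_smul]
    by_contra! h
    exact hi i.toNat (by simp [h])

theorem mulPow_natCast (k : ℕ) (P : ℤ → ℤ → U) (p q : ℤ) :
    mulPow k P p q = ∑ i ∈ Finset.range (k + 1),
      ((-1 : ℂ) ^ i * (k.choose i : ℂ)) • P (p - (k - i)) (q - i) := by
  rw [mulPow, finsum_nat_eq_sum _ (k + 1)]
  · refine Finset.sum_congr rfl fun i _ => ?_
    rw [subPowCoeff_eq, ch_natCast_natCast]; congr 2; ring
  · intro i hi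
    rw [subPowCoeff_eq, ch_natCast_natCast, Nat.choose_eq_zero_of_lt (by omega)]; simp

theorem mulPow_zero (P : ℤ → ℤ → U) : mulPow 0 P = P := by
  ext p q
  have := mulPow_natCast 0 P p q
  simpa using this

theorem mulPow_one (P : ℤ → ℤ → U) (p q : ℤ) :
    mulPow 1 P p q = P (p - 1) q - P p (q - 1) := by
  have := mulPow_natCast 1 P p q
  rw [Nat.cast_one] at this
  rw [this]
  simp [Finset.sum_range_succ, sub_eq_add_neg]

theorem mulPow_swap (k : ℕ) (P : ℤ → ℤ → U) (p q : ℤ) :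
    mulPow k (fun m n => P n m) p q = (-1 : ℂ) ^ k • mulPow k P q p := by
  rw [mulPow_natCast, mulPow_natCast, ← Finset.sum_range_reflect, Finset.smul_sum]
  refine Finset.sum_congr rfl fun i hi => ?_
  rw [Finset.mem_range] at hi
  rw [smul_smul, show k + 1 - 1 - i = k - i by omega, Nat.choose_symm (by omega), ← mul_assoc,
    ← pow_add, show k + i = (k - i) + (i + i) by omega, pow_add (-1 : ℂ) (k - i),
    Even.neg_one_pow ⟨i, rfl⟩, mul_one, Nat.cast_sub (by omega), sub_sub_cancel]

theorem mulPow_smul (n : ℤ) (r : ℂ) (P : ℤ → ℤ → U) (p q : ℤ) :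
    mulPow n (fun m n => r • P m n) p q = r • mulPow n P p q := by
  simp only [mulPow, smul_finsum, smul_comm r]

theorem mulPow_sum (n : ℤ) {ι : Type*} (s : Finset ι) {P : ι → ℤ → ℤ → U}
    (hP : ∀ i, IsDiagTruncated (P i)) (p q : ℤ) :
    mulPow n (fun m n => ∑ i ∈ s, P i m n) p q = ∑ i ∈ s, mulPow n (P i) p q := by
  simp only [mulPow, Finset.smul_sum]
  refine finsum_sum_comm s _ fun i _ => ?_
  obtain ⟨M, hM⟩ := (hP i).exists_bound (p - n + q) q
  refine (Set.finite_Iio M).subset fun l hl => ?_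
  by_contra h
  refine hl ?_
  have := hM l (by simpa using h)
  rw [show p - n + q - (q - l) = p - n + l by ring] at this
  simp only [this, smul_zero]

theorem IsDiagTruncated.mulPow {P : ℤ → ℤ → U} (hP : IsDiagTruncated P) (n : ℤ) :
    IsDiagTruncated (mulPow n P) := fun d => by
  obtain ⟨N, hN⟩ := hP (d - n)
  refine ⟨N, fun q hq => ?_⟩
  rw [WQVA.mulPow]
  refine finsum_eq_zero_of_forall_eq_zero fun i => ?_
  rw [show d - q - n + i = d - n - (q - i) by ring, hN _ (by omega), smul_zero]

/-- Truncation along diagonals makes all sums finite, so Vandermonde applies. In particular (x₁ -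
x₂)ᵏ can be cancelled by (x₁ - x₂)⁻ᵏ. -/
theorem mulPow_mulPow {P : ℤ → ℤ → U} (hP : IsDiagTruncated P) (a b : ℤ) :
    mulPow a (mulPow b P) = mulPow (a + b) P := by
  ext p q
  obtain ⟨M, hM⟩ := hP.exists_bound (p + q - a - b) q
  have h1 : ∀ i : ℤ, M ≤ i → P (p - (a + b) + i) (q - i) = 0 := fun i hi => by
    rw [← hM i hi]; congr 1; ring
  have h2 : ∀ i : ℤ, M ≤ i → mulPow b P (p - a + i) (q - i) = 0 := fun i hi => by
    refine finsum_eq_zero_of_forall_eq_zero fun l => ?_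
    rw [show p - a + i - b + l = p - (a + b) + (i + l) by ring, sub_sub, h1 _ (by omega),
      smul_zero]
  rw [mulPow_eq_sum h1, mulPow_eq_sum h2]
  have h3 : ∀ t ∈ Finset.range M, subPowCoeff (a + b) t • P (p - (a + b) + t) (q - t) =
      ∑ i ∈ Finset.range M, ((-1) ^ t * (ch a i * ch b (t - i))) •
        P (p - (a + b) + t) (q - t) := fun t ht => by
    rw [← Finset.sum_smul, ← Finset.mul_sum, sum_range_ch_mul_ch, subPowCoeff_eq]
    simpa using ht
  rw [Finset.sum_congr rfl h3, Finset.sum_comm]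
  refine Finset.sum_congr rfl fun i _ => ?_
  rw [← finsum_nat_eq_sum _ M fun t ht => by
    rw [h1 _ (by exact_mod_cast ht), smul_zero]]
  rw [finsum_eq_finsum_of_injective (fun l : ℕ => i + l) (add_right_injective i), mulPow,
    smul_finsum]
  · refine finsum_congr fun l => ?_
    rw [smul_smul, subPowCoeff_eq, subPowCoeff_eq, pow_add,
      show ((i + l : ℕ) : ℤ) - i = l by push_cast; ring,
      show p - a + i - b + l = p - (a + b) + (i + l : ℕ) by push_cast; ring,
      show q - i - l = q - (i + l : ℕ) by push_cast; ring]
    congr 1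
    ring
  · intro t ht
    have : t < i := by
      by_contra! h
      exact ht (t - i) (by omega)
    rw [ch_of_neg b (by omega), mul_zero, mul_zero, zero_smul]

theorem mulPow_succ {P : ℤ → ℤ → U} (hP : IsDiagTruncated P) (k : ℕ) :
    mulPow (k + 1 : ℕ) P = mulPow 1 (mulPow k P) := by
  rw [mulPow_mulPow hP]; congr 1; push_cast; ring

theorem IsLaurent₂.mulPow {A : ℤ → ℤ → U} (hA : IsLaurent₂ A) (k : ℕ) :
    IsLaurent₂ (mulPow k A) := by
  obtain ⟨N, hN⟩ := hA
  refine ⟨N, fun p q h => ?_⟩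
  rw [mulPow_natCast]
  refine Finset.sum_eq_zero fun i hi => ?_
  rw [Finset.mem_range] at hi
  rw [hN _ _ (by omega), smul_zero]

/-- The factor (x₁ - x₂)ᵏ becomes zᵏ at x₁ = x₂ + z; one factor at a time, this is Pascal's rule. -/
theorem taylorCoeff_mulPow {A : ℤ → ℤ → U} (hA : IsLaurent₂ A) (k : ℕ) (j c : ℤ) :
    taylorCoeff (mulPow k A) j c = taylorCoeff A (j - k) c := by
  induction k generalizing j with
  | zero => rw [Nat.cast_zero, mulPow_zero, sub_zero]
  | succ k ih =>
    rw [mulPow_succ hA.isDiagTruncated, show j - ((k + 1 : ℕ) : ℤ) = j - 1 - k by push_cast; ring,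
      ← ih]
    have hB := hA.mulPow k
    generalize mulPow (k : ℤ) A = B at hB
    obtain ⟨N, hN⟩ := id hB
    simp only [taylorCoeff, mulPow_one, smul_sub]
    have h1 : (Function.support fun m => ch m j • B (m - 1) (c + j - m)).Finite := by
      refine (Set.finite_Icc (N + 1) (c + j - N)).subset fun m hm => ?_
      by_contra h
      rw [Set.mem_Icc, not_and_or] at h
      exact hm (by simp only [hN (m - 1) (c + j - m) (by omega), smul_zero])
    have e : ∀ m, c + j - m - 1 = c + j - 1 - m := fun m => by ring
    simp only [e]
    rw [finsum_sub_distrib h1 (hB.finite_line _ _), ← finsum_comp_equiv (Equiv.addRight 1)]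
    simp only [Equiv.coe_addRight, add_sub_cancel_right]
    have e' : ∀ m, c + j - (m + 1) = c + j - 1 - m := fun m => by ring
    simp only [e']
    rw [show c + (j - 1) = c + j - 1 by ring]
    rw [← finsum_sub_distrib (hB.finite_line _ _) (hB.finite_line _ _)]
    refine finsum_congr fun m => ?_
    rw [← sub_smul, ch_succ, add_sub_cancel_right]

/-- Multiplication of `A ∈ U((x₁, x₂))` by the difference of the two expansions of
`(x₁ - x₂) ^ N`. -/
theorem mulPow_sub_mulPow_swap {A : ℤ → ℤ → U} (hA : IsLaurent₂ A) (N b c : ℤ) :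
    mulPow N A b c - (-1 : ℂ) ^ N • mulPow N (fun m n => A n m) c b =
      ∑ᶠ m : ℤ, ch (m - b - 1) (-N - 1) • A m (b + c - N - m) := by
  have h1 : mulPow N A b c =
      ∑ᶠ m : ℤ, ((-1) ^ (m - b + N) * ch N (m - b + N)) • A m (b + c - N - m) := by
    rw [mulPow_eq_finsum_int, ← finsum_comp_equiv (Equiv.addRight (N - b))]
    refine finsum_congr fun m => ?_
    simp only [Equiv.coe_addRight]
    rw [show b - N + (m + (N - b)) = m by ring,
      show c - (m + (N - b)) = b + c - N - m by ring, show m + (N - b) = m - b + N by ring]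
  have h2 : (-1 : ℂ) ^ N • mulPow N (fun m n => A n m) c b =
      ∑ᶠ m : ℤ, ((-1) ^ (m - b + N) * ch N (b - m)) • A m (b + c - N - m) := by
    rw [mulPow_eq_finsum_int, smul_finsum, ← finsum_comp_equiv (Equiv.subLeft b)]
    refine finsum_congr fun m => ?_
    rw [Equiv.subLeft_apply, sub_sub_cancel, show c - N + (b - m) = b + c - N - m by ring,
      smul_smul, ← mul_assoc, ← neg_one_zpow_add]
    congr 2
    exact neg_one_zpow_eq ⟨b - m, by ring⟩
  rw [h1, h2, ← finsum_sub_distrib (hA.finite_line _ _) (hA.finite_line _ _)]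
  refine finsum_congr fun m => ?_
  rw [← sub_smul, ← mul_sub, show m - b + N = N - (b - m) by ring, ch_residue]
  congr 2; ring

end TwoVariables

/-! ### The axioms in terms of Taylor coefficients -/

section Coordinates

variable {V : Type*} [AddCommGroup V] [Module ℂ V] {W : Type*} [AddCommGroup W] [Module ℂ W]

theorem substCoeff_phiAdd (A : ℤ → ℤ → W) (j c : ℤ) :
    substCoeff phiAdd A j c = taylorCoeff A j c := by
  rw [substCoeff, taylorCoeff, ← phiFamily_one_one]
  simp only [phiPow_phiFamily, zxCoeff_phiFamily, one_mul]
  rw [finsum_eq_finsum_of_injective (fun m : ℤ => (m, c + j - m)) fun m n h => (Prod.ext_iff.1 h).1]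
  · refine finsum_congr fun m => ?_
    rw [if_pos (by ring)]
  · rintro ⟨m, n⟩ h
    rw [if_neg fun h' => h m (by simp only [Prod.mk.injEq, true_and]; omega), zero_smul]

/-- The coefficient of zʲ in φᵐ is a multiple of the single monomial x^(m + j), so the double sum
collapses to a line. -/
theorem substCoeff_phiStar (A : ℤ → ℤ → W) (j c : ℤ) :
    substCoeff phiStar A j c = ∑ᶠ m : ℤ, ch (-m) j • A m (c - j - m) := by
  rw [substCoeff, ← phiFamily_neg_one_one]
  simp only [phiPow_phiFamily, zxCoeff_phiFamily, neg_mul, one_mul]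
  rw [finsum_eq_finsum_of_injective (fun m : ℤ => (m, c - j - m)) fun m n h => (Prod.ext_iff.1 h).1]
  · refine finsum_congr fun m => ?_
    rw [if_pos (by ring)]
  · rintro ⟨m, n⟩ h
    rw [if_neg fun h' => h m (by simp only [Prod.mk.injEq, true_and]; omega), zero_smul]

theorem iterateCoeff_phiAdd (Y : V →ₗ[ℂ] (ℤ → Module.End ℂ V)) (YW : V →ₗ[ℂ] (ℤ → Module.End ℂ W))
    (k : ℕ) (u v : V) (w : W) (j c : ℤ) :
    iterateCoeff Y YW ((phiAdd - varX) ^ k) u v w j c = YW (Y u (j - k) v) c w := by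
  have h : ∀ p q : ℤ, zxCoeff ((phiAdd - varX) ^ k) p q = if p = k ∧ q = 0 then 1 else 0 := by
    intro p q
    rw [phiAdd, add_sub_cancel_left, varZ, zxCoeff]
    rcases lt_or_ge p 0 with h | h
    · rw [if_neg (by omega), if_neg (by omega)]
    · lift p to ℕ using h
      rw [if_pos (by omega), Int.toNat_natCast, PowerSeries.coeff_X_pow]
      by_cases hp : p = k <;> by_cases hq : q = 0 <;> simp [hp, hq, HahnSeries.coeff_one]
  rw [iterateCoeff, finsum_eq_single _ ((k : ℤ), (0 : ℤ))]
  · simp [h]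
  · rintro ⟨p, q⟩ hpq
    rw [h, if_neg, zero_smul]
    simpa using hpq

theorem iterateCoeff_phiStar (Y : V →ₗ[ℂ] (ℤ → Module.End ℂ V))
    (YW : V →ₗ[ℂ] (ℤ → Module.End ℂ W)) (k : ℕ) (u v : V) (w : W) (j c : ℤ) :
    iterateCoeff Y YW ((phiStar - varX) ^ k) u v w j c =
      ∑ᶠ i : ℕ, ((-1) ^ k * ch (-k) i) • YW (Y u (j - k - i) v) (c - 2 * k - i) w := by
  rw [iterateCoeff]
  simp only [phiStar_sub_varX_pow]
  rw [finsum_eq_finsum_of_injective (fun i : ℕ => ((k + i : ℤ), (2 * k + i : ℤ)))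
    fun m n h => by simpa using (Prod.ext_iff.1 h).1]
  · refine finsum_congr fun i => ?_
    rw [if_pos (by ring), add_sub_cancel_left, sub_sub, sub_sub]
  · rintro ⟨m, n⟩ h
    split_ifs with h'
    · rw [ch_of_neg, mul_zero, zero_smul]
      by_contra! h2
      exact h (m - k).toNat (by simp only [Prod.mk.injEq] at h' h2 ⊢; omega)
    · rw [zero_smul]

end Coordinates

/-! ### Weak associativity and its consequences for modules -/

section Assoc

variable {V : Type*} [AddCommGroup V] [Module ℂ V] {W : Type*} [AddCommGroup W] [Module ℂ W]

/-- The coefficient of `x₁ ^ p * x₂ ^ q` in `Y_W(u, x₁) Y_W(v, x₂) w`. -/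
def prodCoeff (YW : V →ₗ[ℂ] (ℤ → Module.End ℂ W)) (u v : V) (w : W) (p q : ℤ) : W :=
  YW u p (YW v q w)

theorem mulPowCoeff_eq (YW : V →ₗ[ℂ] (ℤ → Module.End ℂ W)) (k : ℕ) (u v : V) (w : W) :
    mulPowCoeff YW k u v w = mulPow k (prodCoeff YW u v w) := by
  ext p q
  rw [mulPow_natCast]
  rfl

theorem isDiagTruncated_prodCoeff {YW : V →ₗ[ℂ] (ℤ → Module.End ℂ W)}
    (hT : ∀ (v : V) (w : W), IsLaurent fun n => YW v n w) (u v : V) (w : W) :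
    IsDiagTruncated (prodCoeff YW u v w) := fun d => by
  obtain ⟨N, hN⟩ := hT v w
  refine ⟨N, fun q hq => ?_⟩
  have := hN q hq
  simp only at this
  rw [prodCoeff, this, map_zero]

/-- Weak associativity for `u, v` on `W`, with exponent `k`. -/
def IsAssocAt (Y : V →ₗ[ℂ] (ℤ → Module.End ℂ V)) (YW : V →ₗ[ℂ] (ℤ → Module.End ℂ W))
    (u v : V) (k : ℕ) : Prop :=
  ∀ w : W, IsLaurent₂ (mulPow k (prodCoeff YW u v w)) ∧
    ∀ j c : ℤ, taylorCoeff (mulPow k (prodCoeff YW u v w)) j c = YW (Y u (j - k) v) c w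

theorem IsModule.exists_isAssocAt {Y : V →ₗ[ℂ] (ℤ → Module.End ℂ V)} {one : V}
    {YW : V →ₗ[ℂ] (ℤ → Module.End ℂ W)} (hW : IsModule Y one YW) (u v : V) :
    ∃ k, IsAssocAt Y YW u v k := by
  obtain ⟨k, h1, h2⟩ := hW.assoc u v
  refine ⟨k, fun w => ⟨mulPowCoeff_eq YW k u v w ▸ h1 w, fun j c => ?_⟩⟩
  rw [← mulPowCoeff_eq, ← substCoeff_phiAdd, h2, iterateCoeff_phiAdd]

/-- An extra factor (x₁ - x₂)ˡ shifts the power of z by l on both sides. Finitely many pairs can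
therefore share one exponent. -/
theorem IsAssocAt.mono {Y : V →ₗ[ℂ] (ℤ → Module.End ℂ V)}
    {YW : V →ₗ[ℂ] (ℤ → Module.End ℂ W)} (hT : ∀ (v : V) (w : W), IsLaurent fun n => YW v n w)
    {u v : V} {k k' : ℕ} (hk : k ≤ k') (h : IsAssocAt Y YW u v k) : IsAssocAt Y YW u v k' := by
  obtain ⟨l, rfl⟩ := Nat.exists_eq_add_of_le hk
  intro w
  have e : mulPow ((k + l : ℕ) : ℤ) (prodCoeff YW u v w) =
      mulPow l (mulPow k (prodCoeff YW u v w)) := by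
    rw [mulPow_mulPow (isDiagTruncated_prodCoeff hT u v w)]
    congr 1; push_cast; ring
  rw [e]
  refine ⟨(h w).1.mulPow l, fun j c => ?_⟩
  rw [taylorCoeff_mulPow (h w).1, (h w).2,
    show j - l - k = j - ((k + l : ℕ) : ℤ) by push_cast; ring]

theorem exists_common_isAssocAt {Y : V →ₗ[ℂ] (ℤ → Module.End ℂ V)}
    {YW : V →ₗ[ℂ] (ℤ → Module.End ℂ W)} (hT : ∀ (v : V) (w : W), IsLaurent fun n => YW v n w)
    (hA : ∀ u v, ∃ k, IsAssocAt Y YW u v k) (u v : V) {r : ℕ} (u' v' : Fin r → V) :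
    ∃ k, IsAssocAt Y YW u v k ∧ ∀ i, IsAssocAt Y YW (v' i) (u' i) k := by
  obtain ⟨k₀, hk₀⟩ := hA u v
  choose k hk using fun i => hA (v' i) (u' i)
  refine ⟨max k₀ (Finset.univ.sup k), hk₀.mono hT (le_max_left _ _), fun i => (hk i).mono hT ?_⟩
  exact (Finset.le_sup (f := k) (Finset.mem_univ i)).trans (le_max_right _ _)

/-- For a series in x₁ alone, as arises from Y_W(u, x₁) Y_W(𝟏, x₂) w. -/
theorem taylorCoeff_mulPow_const {f : ℤ → W} (hf : IsLaurent f) (k : ℕ) (j c : ℤ) :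
    taylorCoeff (mulPow k fun m n => if n = 0 then f m else 0) j c =
      ch (c + j - k) (j - k) • f (c + j - k) := by
  have h : IsLaurent₂ fun m n : ℤ => if n = 0 then f m else 0 := by
    obtain ⟨N, hN⟩ := hf
    refine ⟨min N 0, fun m n h => ?_⟩
    simp only [lt_min_iff] at h
    beta_reduce
    split_ifs with h'
    · exact hN _ (by omega)
    · rfl
  rw [taylorCoeff_mulPow h, taylorCoeff, finsum_eq_single _ (c + j - k)]
  · rw [if_pos (by ring)]
  · intro m hm
    rw [if_neg (by omega), smul_zero]

/-- `Y_W(Y(u, z) 𝟏, x) = Y_W(u, x + z)`. -/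
theorem IsAssocAt.apply_one {Y : V →ₗ[ℂ] (ℤ → Module.End ℂ V)}
    {YW : V →ₗ[ℂ] (ℤ → Module.End ℂ W)} {one u : V} {k : ℕ} (h : IsAssocAt Y YW u one k)
    (hT : ∀ (v : V) (w : W), IsLaurent fun n => YW v n w) (hone : YW one = Pi.single 0 1)
    (j c : ℤ) (w : W) : YW (Y u j one) c w = ch (c + j) j • YW u (c + j) w := by
  have h1 := (h w).2 (j + k) c
  have h2 : prodCoeff YW u one w = fun m n => if n = 0 then YW u m w else 0 := by
    ext m n
    rw [prodCoeff, hone]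
    split_ifs with hn
    · simp [hn]
    · simp [Pi.single_eq_of_ne hn]
  rw [h2, taylorCoeff_mulPow_const (hT u w)] at h1
  rw [add_sub_cancel_right, ← add_assoc, add_sub_cancel_right] at h1
  exact h1.symm

/-- The iterate side of the Jacobi identity for `A ∈ W((x₁, x₂))`. -/
theorem finsum_subPowCoeff_smul_taylorCoeff {A : ℤ → ℤ → W} (hA : IsLaurent₂ A) (b e f : ℤ) :
    ∑ᶠ i : ℕ, subPowCoeff (b + i) i • taylorCoeff A (e - i) (f + i) =
      ∑ᶠ m : ℤ, ch (m - b - 1) e • A m (e + f - m) := by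
  obtain ⟨N, hN⟩ := hA
  rw [finsum_nat_eq_sum _ (e + 1).toNat fun l hl => by
    rw [taylorCoeff_of_neg _ (by omega), smul_zero]]
  have h1 : ∀ i : ℕ, taylorCoeff A (e - i) (f + i) =
      ∑ m ∈ Finset.Icc N (e + f - N), ch m (e - i) • A m (e + f - m) := fun l =>
    taylorCoeff_eq_sum hN (by ring)
  simp only [h1, Finset.smul_sum, smul_smul]
  rw [Finset.sum_comm, finsum_line_eq_sum hN]
  refine Finset.sum_congr rfl fun m _ => ?_
  rw [← Finset.sum_smul]
  congr 1
  rw [show m - b - 1 = (-b - 1) + m by ring,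
    ← sum_range_ch_mul_ch (M := (e + 1).toNat) _ _ _ (by omega)]
  refine Finset.sum_congr rfl fun i _ => ?_
  rw [ch_neg (-b - 1), show (i : ℤ) - (-b - 1) - 1 = b + i by ring, subPowCoeff_eq, zpow_natCast]

/-- Commutativity on a module from the skew symmetry of its iterates. -/
theorem mulPow_prodCoeff_eq_of_skew {Y : V →ₗ[ℂ] (ℤ → Module.End ℂ V)}
    {YW : V →ₗ[ℂ] (ℤ → Module.End ℂ W)} {u v : V} {r : ℕ} {u' v' : Fin r → V} {k : ℕ}
    (h : IsAssocAt Y YW u v k) (h' : ∀ i, IsAssocAt Y YW (v' i) (u' i) k) (w : W)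
    (hskew : ∀ j c, taylorCoeff (fun m n => mulPow k (prodCoeff YW u v w) n m) j c =
      (-1 : ℂ) ^ k • YW (∑ i, Y (v' i) (j - k) (u' i)) c w) (p q : ℤ) :
    mulPow k (prodCoeff YW u v w) p q =
      (-1 : ℂ) ^ k • ∑ i, mulPow k (prodCoeff YW (v' i) (u' i) w) q p := by
  have hL : ∀ i, IsLaurent₂ (mulPow k (prodCoeff YW (v' i) (u' i) w)) := fun i => (h' i w).1
  refine eq_of_taylorCoeff_eq (A := fun m n => mulPow k (prodCoeff YW u v w) n m)
    (B := fun m n => (-1 : ℂ) ^ k • ∑ i, mulPow k (prodCoeff YW (v' i) (u' i) w) m n)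
    (h w).1.swap ((IsLaurent₂.sum _ hL).smul _) (fun j c => ?_) q p
  rw [hskew, taylorCoeff_smul, taylorCoeff_sum _ hL]
  simp only [(h' _ w).2, map_sum, Finset.sum_apply, LinearMap.sum_apply]

end Assoc

/-! ### The Jacobi identity for constant `S` -/

section Jacobi

variable {V : Type*} [AddCommGroup V] [Module ℂ V] {Y : V →ₗ[ℂ] (ℤ → Module.End ℂ V)}

theorem jacobiLeft₁_eq (u v w : V) (a b c : ℤ) :
    jacobiLeft₁ Y u v w a b c = mulPow (-a - 1) (prodCoeff Y u v w) b c := by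
  refine finsum_congr fun i => ?_
  rw [prodCoeff, sub_add]

theorem jacobiLeft₂_one_eq (u v w : V) (a b c : ℤ) : jacobiLeft₂ Y 1 u v w a b c =
    (-1 : ℂ) ^ (-a - 1) • mulPow (-a - 1) (prodCoeff Y v u w) c b := by
  rw [jacobiLeft₂, finsum_eq_finsum_of_injective (fun i : ℕ => ((0 : ℤ), i))
    fun m n h => (Prod.ext_iff.1 h).2]
  · congr 1
    refine finsum_congr fun i => ?_
    simp only [prodCoeff, HahnSeries.coeff_one, if_true, one_mul, add_zero, sub_add]
  · rintro ⟨m, i⟩ h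
    have : m ≠ 0 := fun hm => h i (by simp [hm])
    simp [HahnSeries.coeff_one, this]

theorem sJacobi_one_iff (hT : ∀ u v : V, IsLaurent fun n => Y u n v) (u v : V) {r : ℕ}
    (u' v' : Fin r → V) : SJacobi Y u v u' v' (fun _ => 1) ↔ ∀ (w : V) (a b c : ℤ),
      mulPow (-a - 1) (prodCoeff Y u v w) b c - (-1 : ℂ) ^ (-a - 1) •
        mulPow (-a - 1) (fun q p => ∑ i, prodCoeff Y (v' i) (u' i) w q p) c b =
      jacobiRight Y u v w a b c := by
  simp only [SJacobi, jacobiLeft₁_eq, jacobiLeft₂_one_eq]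
  refine forall₄_congr fun w a b c => ?_
  rw [mulPow_sum _ _ fun i => isDiagTruncated_prodCoeff hT _ _ _, Finset.smul_sum]

theorem isDiagTruncated_sum_prodCoeff (hT : ∀ u v : V, IsLaurent fun n => Y u n v) {r : ℕ}
    (u' v' : Fin r → V) (w : V) :
    IsDiagTruncated fun q p => ∑ i, prodCoeff Y (v' i) (u' i) w q p := fun d => by
  choose N hN using fun i => isDiagTruncated_prodCoeff hT (v' i) (u' i) w d
  obtain ⟨M, hM⟩ := (Set.finite_range N).bddBelow
  exact ⟨M, fun q hq => Finset.sum_eq_zero fun i _ =>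
    hN i q (hq.trans_le (hM (Set.mem_range_self i)))⟩

/-- Commutativity and associativity imply the Jacobi identity. -/
theorem sJacobi_of_isAssocAt (hT : ∀ u v : V, IsLaurent fun n => Y u n v) {u v : V} {r : ℕ}
    {u' v' : Fin r → V} {k : ℕ} (h : IsAssocAt Y Y u v k)
    (hcomm : ∀ w p q, mulPow k (prodCoeff Y u v w) p q =
      (-1 : ℂ) ^ k • ∑ i, mulPow k (prodCoeff Y (v' i) (u' i) w) q p) :
    SJacobi Y u v u' v' (fun _ => 1) := by
  rw [sJacobi_one_iff hT]
  intro w a b c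
  have hP := isDiagTruncated_prodCoeff hT u v w
  have hQ := isDiagTruncated_sum_prodCoeff hT u' v' w
  obtain ⟨hA, hR⟩ := h w
  -- Both products are negative or positive powers of x₁ - x₂ times the same Laurent series A, so
  -- their difference is governed by the two expansions of (x₁ - x₂)^(-a-1-k).
  have e1 : mulPow (-a - 1) (prodCoeff Y u v w) =
      mulPow (-a - 1 - k) (mulPow k (prodCoeff Y u v w)) := by
    rw [mulPow_mulPow hP, sub_add_cancel]
  have e2 : mulPow (-a - 1) (fun q p => ∑ i, prodCoeff Y (v' i) (u' i) w q p) c b =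
      (-1 : ℂ) ^ k • mulPow (-a - 1 - k) (fun q p => mulPow k (prodCoeff Y u v w) p q) c b := by
    rw [← mulPow_smul, ← sub_add_cancel (-a - 1) (k : ℤ), ← mulPow_mulPow hQ, add_sub_cancel_right]
    congr 1
    ext q p
    rw [hcomm, smul_smul, ← mul_pow, mulPow_sum _ _ fun i => isDiagTruncated_prodCoeff hT _ _ _]
    simp
  have e3 : (-1 : ℂ) ^ (-a - 1) * (-1) ^ k = (-1) ^ (-a - 1 - k) := by
    rw [neg_one_zpow_sub _ (k : ℤ), zpow_natCast]
  rw [e1, e2, smul_smul, e3, mulPow_sub_mulPow_swap hA, jacobiRight]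
  have e4 := finsum_subPowCoeff_smul_taylorCoeff hA b (a + k) (c + b + 1)
  rw [show -(-a - 1 - k) - 1 = a + k by ring,
    show b + c - (-a - 1 - k) = a + k + (c + b + 1) by ring, ← e4]
  refine finsum_congr fun i => ?_
  rw [hR, show a + k - i - k = a - i by ring, show c + b + 1 + i = c + (b + i) + 1 by ring]

/-- At the coefficient of x₁⁻¹ the binomials have upper entry i - 1 and lower entry i, which vanish
for i > 0. -/
theorem jacobiRight_neg_one (u v w : V) (a c : ℤ) :
    jacobiRight Y u v w a (-1) c = Y (Y u a v) c w := by
  rw [jacobiRight, finsum_eq_single _ 0]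
  · simp [subPowCoeff]
  · intro i hi
    rw [subPowCoeff_eq, ch_eq_zero_of_lt (by omega) (by omega), mul_zero, zero_smul]

/-- The Jacobi identity implies associativity. -/
theorem SJacobi.exists_isAssocAt (hT : ∀ u v : V, IsLaurent fun n => Y u n v) {u v : V} {r : ℕ}
    {u' v' : Fin r → V} (h : SJacobi Y u v u' v' (fun _ => 1)) : ∃ k, IsAssocAt Y Y u v k := by
  rw [sJacobi_one_iff hT] at h
  obtain ⟨N, hN⟩ := hT u v
  refine ⟨(-N).toNat, fun w => ?_⟩
  obtain ⟨k, hk⟩ : ∃ k, k = (-N).toNat := ⟨_, rfl⟩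
  rw [← hk]
  have hP := isDiagTruncated_prodCoeff hT u v w
  have hQ := isDiagTruncated_sum_prodCoeff hT u' v' w
  -- The coefficient of x₀^(-k-1) of the Jacobi identity: k is chosen so that Y(u, x₀)v has no power
  -- below -k, hence the iterate side vanishes.
  have hcomm : ∀ p q, mulPow k (prodCoeff Y u v w) p q = (-1 : ℂ) ^ k •
      mulPow k (fun q p => ∑ i, prodCoeff Y (v' i) (u' i) w q p) q p := fun p q => by
    have := h w (-k - 1) p q
    rw [show -(-(k : ℤ) - 1) - 1 = k by ring, zpow_natCast, jacobiRight,
      finsum_eq_zero_of_forall_eq_zero fun i => ?_] at this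
    · exact sub_eq_zero.1 this
    · have h0 : Y u (-k - 1 - i) v = 0 := hN _ (by omega)
      simp [h0]
  -- Y(v, x₂) acting first bounds the powers of x₂; after commuting, Y(u⁽ⁱ⁾, x₁) acts first and
  -- bounds those of x₁.
  have hA : IsLaurent₂ (mulPow k (prodCoeff Y u v w)) := by
    obtain ⟨N₁, hN₁⟩ := hT v w
    choose N₂ hN₂ using fun i => hT (u' i) w
    obtain ⟨M, hM⟩ := (Set.finite_range N₂).bddBelow
    refine ⟨min N₁ M, fun p q hpq => ?_⟩
    simp only [lt_min_iff] at hpq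
    rcases hpq with hp | hq
    · rw [hcomm, mulPow_natCast, Finset.sum_eq_zero, smul_zero]
      intro i _
      rw [Finset.sum_eq_zero, smul_zero]
      intro l _
      have : Y (u' l) (p - i) w = 0 := hN₂ l _ (by have := hM (Set.mem_range_self l); omega)
      rw [prodCoeff, this, map_zero]
    · rw [mulPow_natCast, Finset.sum_eq_zero]
      intro i _
      have : Y v (q - i) w = 0 := hN₁ _ (by omega)
      rw [prodCoeff, this, map_zero, smul_zero]
  refine ⟨hA, fun j c => ?_⟩
  -- At x₁⁻¹ the right side is a bare iterate, while the difference of the two expansions of (x₁ -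
  -- x₂)^(-j-1) extracts a Taylor coefficient of A.
  have hJ := h w (j - k) (-1) c
  have e1 : mulPow (-(j - k) - 1) (prodCoeff Y u v w) =
      mulPow (-j - 1) (mulPow k (prodCoeff Y u v w)) := by
    rw [mulPow_mulPow hP]; congr 1; ring
  have e2 : mulPow (-(j - k) - 1) (fun q p => ∑ i, prodCoeff Y (v' i) (u' i) w q p) c (-1) =
      (-1 : ℂ) ^ k • mulPow (-j - 1) (fun q p => mulPow k (prodCoeff Y u v w) p q) c (-1) := by
    rw [← mulPow_smul, show -(j - k) - 1 = -j - 1 + (k : ℤ) by ring, ← mulPow_mulPow hQ]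
    congr 1
    ext q p
    rw [hcomm, smul_smul, ← mul_pow]
    simp
  have e3 : (-1 : ℂ) ^ (-(j - k) - 1) * (-1) ^ k = (-1) ^ (-j - 1) := by
    rw [← zpow_natCast, ← neg_one_zpow_add]
    exact neg_one_zpow_eq ⟨k, by ring⟩
  rw [e1, e2, smul_smul, e3, mulPow_sub_mulPow_swap hA, jacobiRight_neg_one] at hJ
  rw [← hJ, taylorCoeff]
  refine finsum_congr fun m => ?_
  rw [show m - -1 - 1 = m by ring, show -(-j - 1) - 1 = j by ring,
    show -1 + c - (-j - 1) - m = c + j - m by ring]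

end Jacobi

/-! ### Changing variables `(y₁, y₂) = (-x₁, x₂ - x₁)` -/

theorem sum_range_succ_ch_mul_ch (a : ℕ) (b j : ℤ) :
    ∑ i ∈ Finset.range (a + 1), ch a i * ch b (j - i) = ch (a + b) j := by
  rw [← sum_range_ch_mul_ch _ _ _ (M := a + 1 + (j + 1).toNat) (by omega)]
  refine Finset.sum_subset (Finset.range_subset_range.2 (by omega)) fun i _ hi => ?_
  rw [Finset.mem_range] at hi
  rw [ch_eq_zero_of_lt (by omega) (by omega), zero_mul]

theorem finite_support_ch_mul_ch (e j : ℤ) (k Q : ℕ) : (Function.support fun n : ℤ =>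
    ch n j * ((-1) ^ (e - n) * ch Q (n + k))).Finite := by
  refine (Set.finite_Icc (-k : ℤ) (Q - k)).subset fun n hn => ?_
  by_contra h
  rw [Set.mem_Icc, not_and_or] at h
  refine hn ?_
  have : ch Q (n + k) = 0 := by
    rcases h with h | h
    · exact ch_of_neg _ (by omega)
    · exact ch_eq_zero_of_lt (by omega) (by omega)
  simp only [this, mul_zero]

/-- After the shift n = i - k this is an alternating binomial sum. It is the scalar identity behind
setting x₂ = x₁ + z in the reflected series. -/
theorem finsum_ch_mul_ch (e j : ℤ) (k Q : ℕ) :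
    ∑ᶠ n : ℤ, ch n j * ((-1) ^ (e - n) * ch Q (n + k)) =
      (-1) ^ (e + k + Q) * ch (-k) (j - Q) := by
  rw [← finsum_comp_equiv (Equiv.subRight (k : ℤ)),
    finsum_eq_finsum_of_injective (fun i : ℕ => (i : ℤ)) Nat.cast_injective,
    finsum_nat_eq_sum _ (Q + 1)]
  · rw [neg_one_zpow_add, mul_assoc, zpow_natCast, ← sum_range_alternating_choose_mul_ch,
      Finset.mul_sum]
    refine Finset.sum_congr rfl fun i _ => ?_
    rw [Equiv.subRight_apply, sub_add_cancel, ch_natCast_natCast,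
      show e - (i - k : ℤ) = e + k - i by ring, neg_one_zpow_sub, zpow_natCast,
      show -(k : ℤ) + i = i - k by ring]
    ring
  · intro i hi
    rw [Equiv.subRight_apply, sub_add_cancel, ch_eq_zero_of_lt (n := Q) (by omega) (by omega)]
    simp
  · intro n hn
    rw [Equiv.subRight_apply, sub_add_cancel, ch_of_neg (Q : ℤ)]
    · simp
    · by_contra! h
      exact hn n.toNat (by simp [h])

section ChangeOfVariables

variable {U : Type*} [AddCommGroup U] [Module ℂ U]

/-- The coefficients of `A(-x₁, -x₁ + x₂) * (-x₂) ^ (-k)`, expanded in nonnegative powers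
of `x₂`. -/
def reflectCoeff (k : ℕ) (A : ℤ → ℤ → U) (m n : ℤ) : U :=
  (-1 : ℂ) ^ (m + k) • taylorCoeff (fun p q => A q p) (n + k) m

variable {A : ℤ → ℤ → U} {N : ℤ}

/-- The change of variables is homogeneous and A has total degrees at least 2N; the factor (-x₂)⁻ᵏ
accounts for k. This keeps later interchanges of sums finite. -/
theorem reflectCoeff_eq_zero (hN : ∀ m n : ℤ, (m < N ∨ n < N) → A m n = 0)
    (k : ℕ) {m n : ℤ} (h : m + n + k < 2 * N) :
    reflectCoeff k A m n = 0 := by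
  rw [reflectCoeff, taylorCoeff_eq_sum (fun m n h => hN n m h.symm) rfl, Finset.Icc_eq_empty,
    Finset.sum_empty, smul_zero]
  omega

/-- A power (x₂ - x₁)^q times (x₁ - x₂)ˡ is, up to sign, (x₂ - x₁)^(l + q). -/
theorem mulPow_reflectCoeff (hN : ∀ m n : ℤ, (m < N ∨ n < N) → A m n = 0)
    (k l : ℕ) (m n : ℤ) : mulPow l (reflectCoeff k A) m n =
    (-1 : ℂ) ^ (m - l + k) • ∑ q ∈ Finset.Icc N (m + n + k - l - N),
      ch (l + q) (n + k) • A (m + n + k - l - q) q := by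
  have h1 : ∀ i : ℕ, reflectCoeff k A (m - (l - i)) (n - i) =
      (-1 : ℂ) ^ (m - (l - i) + k) • ∑ q ∈ Finset.Icc N (m + n + k - l - N),
        ch q (n + k - i) • A (m + n + k - l - q) q := fun i => by
    rw [reflectCoeff, taylorCoeff_eq_sum (fun m n h => hN n m h.symm)
      (show m - (l - i) + (n - i + k) = m + n + k - l by ring),
      show n + k - i = n - i + k by ring]
  rw [mulPow_natCast]
  simp only [h1, Finset.smul_sum, smul_smul]
  rw [Finset.sum_comm]
  refine Finset.sum_congr rfl fun q _ => ?_
  rw [← Finset.sum_smul, ← sum_range_succ_ch_mul_ch, Finset.mul_sum]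
  congr 1
  refine Finset.sum_congr rfl fun i _ => ?_
  rw [ch_natCast_natCast, show m - (l - i : ℤ) + k = m - l + k + i by ring,
    neg_one_zpow_add (m - l + k), zpow_natCast]
  have : (-1 : ℂ) ^ i * (-1) ^ i = 1 := by rw [← mul_pow]; simp
  linear_combination (l.choose i * (-1 : ℂ) ^ (m - l + k) * ch q (n + k - i)) * this

/-- The exponents l + q are now nonnegative, so only polynomials in x₂ - x₁ occur, and the pole in
x₂ has order at most k. -/
theorem isLaurent₂_mulPow_reflectCoeff (hN : ∀ m n : ℤ, (m < N ∨ n < N) → A m n = 0)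
    {l : ℕ} (hl : ∀ p q : ℤ, q < -l → A p q = 0) (k : ℕ) : IsLaurent₂ (mulPow l (reflectCoeff k A)) := by
  refine ⟨min N (-k), fun m n h => ?_⟩
  simp only [lt_min_iff] at h
  rw [mulPow_reflectCoeff hN, Finset.sum_eq_zero, smul_zero]
  intro q _
  by_cases hq : q < -l
  · rw [hl _ _ hq, smul_zero]
  by_cases hn : n + k < 0
  · rw [ch_of_neg _ hn, zero_smul]
  by_cases hq' : l + q < n + k
  · rw [ch_eq_zero_of_lt (by omega) hq', zero_smul]
  · rw [hN _ _ (by omega), smul_zero]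

/-- At x₂ = x₁ + z one has y₁ = -x₁ and y₂ = z, so the result is (-z)ˡ P(-x₁, z), with P recovered
from A by dividing by (y₁ - y₂)ᵏ. -/
theorem taylorCoeff_mulPow_reflectCoeff (hN : ∀ m n : ℤ, (m < N ∨ n < N) → A m n = 0)
    {l : ℕ} (hl : ∀ p q : ℤ, q < -l → A p q = 0) {k : ℕ} {P : ℤ → ℤ → U} (hP : IsDiagTruncated P)
    (hA : A = mulPow k P) (j c : ℤ) :
    taylorCoeff (fun m n => mulPow l (reflectCoeff k A) n m) j c =
      (-1 : ℂ) ^ (l + c) • P c (j - l) := by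
  have h1 : ∀ n, ch n j • mulPow l (reflectCoeff k A) (c + j - n) n =
      ∑ q ∈ Finset.Icc N (c + j + k - l - N),
        (ch n j * ((-1) ^ (c + j - l + k - n) * ch (l + q) (n + k))) •
          A (c + j + k - l - q) q := fun n => by
    rw [mulPow_reflectCoeff hN, Finset.smul_sum, Finset.smul_sum,
      show c + j - n + n + k - l = c + j + k - l by ring]
    refine Finset.sum_congr rfl fun q _ => ?_
    rw [smul_smul, smul_smul, show c + j - n - l + k = c + j - l + k - n by ring, mul_assoc]
  have h2 : ∀ q : ℤ, -l ≤ q → (Function.support fun n : ℤ =>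
      (ch n j * ((-1) ^ (c + j - l + k - n) * ch (l + q) (n + k)))).Finite := fun q hq => by
    obtain ⟨Q, hQ⟩ := Int.eq_ofNat_of_zero_le (a := l + q) (by omega)
    rw [hQ]
    exact finite_support_ch_mul_ch _ _ _ _
  rw [taylorCoeff, finsum_congr h1, finsum_sum_comm]
  · have h3 : P = mulPow (-k) A := by
      rw [hA, mulPow_mulPow hP, neg_add_cancel, mulPow_zero]
    rw [h3, mulPow_eq_finsum_int, ← finsum_comp_equiv (Equiv.subLeft (j - l)), smul_finsum]
    have h4 : ∀ q, (-1 : ℂ) ^ (l + c) •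
        (((-1 : ℂ) ^ Equiv.subLeft (j - l : ℤ) q * ch (-k) (Equiv.subLeft (j - l : ℤ) q)) •
          A (c - -k + Equiv.subLeft (j - l : ℤ) q) (j - l - Equiv.subLeft (j - l : ℤ) q)) =
        ((-1 : ℂ) ^ (c + j + q) * ch (-k) (j - l - q)) • A (c + j + k - l - q) q := fun q => by
      rw [Equiv.subLeft_apply, sub_sub_cancel, smul_smul, ← mul_assoc, ← neg_one_zpow_add,
        show c - -k + (j - l - q) = c + j + k - l - q by ring,
        neg_one_zpow_eq (m := l + c + (j - l - q)) (n := c + j + q) ⟨-q, by ring⟩]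
    rw [finsum_congr h4, finsum_int_eq_sum _ N (c + j + k - l - N) fun q hq => by
      rw [hN _ _ (by omega), smul_zero]]
    refine Finset.sum_congr rfl fun q _ => ?_
    by_cases hq : q < -l
    · simp [hl _ _ hq]
    · rw [← finsum_smul' (h2 q (by omega))]
      obtain ⟨Q, hQ⟩ := Int.eq_ofNat_of_zero_le (a := l + q) (by omega)
      rw [hQ, finsum_ch_mul_ch, show j - l - q = j - Q by omega]
      congr 2
      exact neg_one_zpow_eq ⟨k, by omega⟩
  · intro q _
    by_cases hq : q < -l
    · simp [hl _ _ hq, Function.HasFiniteSupport]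
    · refine (h2 q (by omega)).subset fun n hn => ?_
      rw [Function.mem_support] at hn ⊢
      exact fun h => hn (by rw [h, zero_smul])

end ChangeOfVariables

/-! ### The opposite algebra -/

section Opposite

variable {V : Type*} [AddCommGroup V] [Module ℂ V] {Y : V →ₗ[ℂ] (ℤ → Module.End ℂ V)} {one : V}

theorem exists_isAssocAt_self (hV : IsWeakQuantumVertexAlgebra Y one) (hS : HasConstantS Y)
    (u v : V) : ∃ k, IsAssocAt Y Y u v k := by
  obtain ⟨S, hS⟩ := hS
  obtain ⟨r, u', v', -, h⟩ := hS u v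
  exact h.exists_isAssocAt hV.truncation

/-- Induction using Y(Y(a, z)𝟏, x) = Y(a, x + z), applied to 𝟏. It makes exp(x𝒟)a equal to Y(a, x)𝟏.
-/
theorem derivOp_pow_apply (hV : IsWeakQuantumVertexAlgebra Y one)
    (hA : ∀ u v, ∃ k, IsAssocAt Y Y u v k) (i : ℕ) (a : V) :
    (derivOp Y one ^ i) a = (i.factorial : ℂ) • Y a i one := by
  induction i with
  | zero => simp [hV.creation_limit]
  | succ i ih =>
    obtain ⟨k, hk⟩ := hA a one
    have h : ∀ b, derivOp Y one b = Y b 1 one := fun b => rfl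
    rw [pow_succ', Module.End.mul_apply, ih, map_smul, h,
      hk.apply_one hV.truncation hV.vacuum i 1 one, smul_smul]
    have e : (1 : ℤ) + i = ((i + 1 : ℕ) : ℤ) := by push_cast; ring
    rw [e, ch_natCast_natCast, Nat.choose_succ_self_right, Nat.factorial_succ]
    congr 1
    push_cast; ring

/-- `Yᵒ(u, x) v = ∑ₗ xˡ Y(Y(v, -x) u)ₗ 𝟏`. -/
theorem oppositeY_apply (hV : IsWeakQuantumVertexAlgebra Y one)
    (hA : ∀ u v, ∃ k, IsAssocAt Y Y u v k) (u v : V) (n : ℤ) :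
    oppositeY Y one hV.truncation u n v =
      ∑ᶠ i : ℕ, (-1 : ℂ) ^ (n - i) • Y (Y v (n - i) u) i one := by
  change ∑ᶠ i : ℕ, oppositeTerm Y one u v n i = _
  refine finsum_congr fun i => ?_
  rw [oppositeTerm, derivOp_pow_apply hV hA, smul_smul, mul_right_comm,
    inv_mul_cancel₀ (by exact_mod_cast i.factorial_ne_zero), one_mul]

theorem oppositeY_apply_eq_sum (hV : IsWeakQuantumVertexAlgebra Y one)
    (hA : ∀ u v, ∃ k, IsAssocAt Y Y u v k) {u v : V} {n : ℤ} {M : ℕ}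
    (hM : ∀ i : ℕ, M ≤ i → Y v (n - i) u = 0) :
    oppositeY Y one hV.truncation u n v =
      ∑ i ∈ Finset.range M, (-1 : ℂ) ^ (n - i) • Y (Y v (n - i) u) i one := by
  rw [oppositeY_apply hV hA, finsum_nat_eq_sum _ M fun i hi => by simp [hM i hi]]

theorem exists_truncation_bound {W : Type*} [AddCommGroup W] [Module ℂ W]
    {YW : V →ₗ[ℂ] (ℤ → Module.End ℂ W)} (hT : ∀ (v : V) (w : W), IsLaurent fun n => YW v n w)
    (v : V) (w : W) (n : ℤ) : ∃ M : ℕ, ∀ i : ℕ, M ≤ i → YW v (n - i) w = 0 := by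
  obtain ⟨N, hN⟩ := hT v w
  exact ⟨(n - N + 1).toNat, fun i hi => hN _ (by omega)⟩

/-- `Y_W(Yᵒ(v, z) u, x) = Y_W(Y(u, -z) v, x + z)`. -/
theorem apply_oppositeY (hV : IsWeakQuantumVertexAlgebra Y one)
    (hA : ∀ u v, ∃ k, IsAssocAt Y Y u v k) {W : Type*} [AddCommGroup W] [Module ℂ W]
    {YW : V →ₗ[ℂ] (ℤ → Module.End ℂ W)}
    (hD : ∀ (a : V) (l : ℕ) (c : ℤ) (w : W), YW (Y a l one) c w = ch (c + l) l • YW a (c + l) w)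
    (u v : V) (j c : ℤ) (w : W) : YW (oppositeY Y one hV.truncation v j u) c w =
      ∑ᶠ l : ℕ, ((-1 : ℂ) ^ (j - l) * ch (c + l) l) • YW (Y u (j - l) v) (c + l) w := by
  obtain ⟨M, hM⟩ := exists_truncation_bound hV.truncation u v j
  rw [oppositeY_apply_eq_sum hV hA hM, finsum_nat_eq_sum _ M fun i hi => by simp [hM i hi]]
  simp only [map_sum, Finset.sum_apply, LinearMap.sum_apply, map_smul, Pi.smul_apply,
    LinearMap.smul_apply, hD, smul_smul]

/-- The exchanged expansion formula and the formula for iterates of Yᵒ have the same binomial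
coefficients. This is where the opposite algebra enters. -/
theorem IsAssocAt.taylorCoeff_swap (hV : IsWeakQuantumVertexAlgebra Y one)
    (hA : ∀ u v, ∃ k, IsAssocAt Y Y u v k) {W : Type*} [AddCommGroup W] [Module ℂ W]
    {YW : V →ₗ[ℂ] (ℤ → Module.End ℂ W)}
    (hD : ∀ (a : V) (l : ℕ) (c : ℤ) (w : W), YW (Y a l one) c w = ch (c + l) l • YW a (c + l) w)
    {u v : V} {k : ℕ} (h : IsAssocAt Y YW u v k) (w : W) (j c : ℤ) :
    taylorCoeff (fun m n => mulPow k (prodCoeff YW u v w) n m) j c =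
      (-1 : ℂ) ^ k • YW (oppositeY Y one hV.truncation v (j - k) u) c w := by
  rw [WQVA.taylorCoeff_swap (h w).1, apply_oppositeY hV hA hD, smul_finsum]
  refine finsum_congr fun l => ?_
  rw [(h w).2, smul_smul, ← mul_assoc, ← zpow_natCast, ← neg_one_zpow_add,
    show j - l - k = j - k - l by ring,
    neg_one_zpow_eq (m := k + (j - k - l)) (n := j - l) ⟨0, by ring⟩]

theorem apply_one_apply (hV : IsWeakQuantumVertexAlgebra Y one)
    (hA : ∀ u v, ∃ k, IsAssocAt Y Y u v k) (a : V) (l : ℕ) (c : ℤ) (w : V) :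
    Y (Y a l one) c w = ch (c + l) l • Y a (c + l) w := by
  obtain ⟨k, hk⟩ := hA a one
  exact hk.apply_one hV.truncation hV.vacuum _ _ _

/-- The opposite of the opposite algebra is the original one. -/
theorem finsum_oppositeY (hV : IsWeakQuantumVertexAlgebra Y one)
    (hA : ∀ u v, ∃ k, IsAssocAt Y Y u v k) (u v : V) (j : ℤ) :
    ∑ᶠ l : ℕ, (-1 : ℂ) ^ (j - l) • Y (oppositeY Y one hV.truncation v (j - l) u) l one =
      Y u j v := by
  obtain ⟨k, hk⟩ := hA u v
  obtain ⟨h1, h2⟩ := hk one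
  have h3 := h2 (j + k) 0
  rw [add_sub_cancel_right, hV.creation_limit, WQVA.taylorCoeff_swap h1.swap] at h3
  rw [← h3]
  refine finsum_congr fun l => ?_
  rw [hk.taylorCoeff_swap hV hA (apply_one_apply hV hA), zero_add, ← ch_symm (by omega), sub_self,
    ch_zero_right, mul_one, smul_smul, show j + k - l - k = j - l by ring, ← zpow_natCast,
    ← neg_one_zpow_add]
  congr 1
  exact neg_one_zpow_eq ⟨-k, by ring⟩

/-- Skew symmetry. -/
theorem oppositeY_eq_sum_of_sJacobi (hV : IsWeakQuantumVertexAlgebra Y one)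
    (hA : ∀ u v, ∃ k, IsAssocAt Y Y u v k) {u v : V} {r : ℕ} {u' v' : Fin r → V}
    (h : SJacobi Y u v u' v' (fun _ => 1)) (a : ℤ) :
    oppositeY Y one hV.truncation v a u = ∑ i, Y (v' i) a (u' i) := by
  rw [sJacobi_one_iff hV.truncation] at h
  have h1 := h one a 0 (-1)
  have h2 : mulPow (-a - 1) (prodCoeff Y u v one) 0 (-1) = 0 :=
    finsum_eq_zero_of_forall_eq_zero fun i => by
      rw [prodCoeff, hV.creation v _ (by omega), map_zero, smul_zero]
  have h3 : mulPow (-a - 1) (fun q p => ∑ i, prodCoeff Y (v' i) (u' i) one q p) (-1) 0 =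
      ∑ i, Y (v' i) a (u' i) := by
    rw [mulPow, finsum_eq_single _ 0]
    · simp [subPowCoeff, prodCoeff, hV.creation_limit, show (-1 : ℤ) - (-a - 1) = a by ring]
    · intro i hi
      rw [Finset.sum_eq_zero, smul_zero]
      intro l _
      rw [prodCoeff, hV.creation _ _ (by omega), map_zero]
  rw [h2, h3, zero_sub, jacobiRight] at h1
  rw [oppositeY_apply hV hA]
  have h4 : ∀ x : V, (-1 : ℂ) ^ a • -((-1 : ℂ) ^ (-a - 1) • x) = x := fun x => by
    rw [smul_neg, smul_smul, ← neg_one_zpow_add, show a + (-a - 1) = -1 by ring]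
    simp
  rw [← h4 (∑ i, Y (v' i) a (u' i)), h1, smul_finsum]
  refine finsum_congr fun i => ?_
  rw [subPowCoeff_eq, zero_add, show (-1 : ℤ) + i + 1 = i by ring, ← ch_symm (by omega), sub_self,
    ch_zero_right, mul_one, smul_smul, neg_one_zpow_sub, zpow_natCast]

/-- Skew symmetry of Y with the opposite taken once more, by (Vᵒ)ᵒ = V. -/
theorem eq_sum_oppositeY_of_sJacobi (hV : IsWeakQuantumVertexAlgebra Y one)
    (hA : ∀ u v, ∃ k, IsAssocAt Y Y u v k) {u v : V} {r : ℕ} {u' v' : Fin r → V}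
    (h : SJacobi Y v u v' u' (fun _ => 1)) (j : ℤ) :
    Y v j u = ∑ i, oppositeY Y one hV.truncation (v' i) j (u' i) := by
  rw [← finsum_oppositeY hV hA]
  simp only [oppositeY_eq_sum_of_sJacobi hV hA h, map_sum, Finset.sum_apply, LinearMap.sum_apply,
    Finset.smul_sum, oppositeY_apply hV hA]
  refine finsum_sum_comm _ _ fun i _ => ?_
  obtain ⟨M, hM⟩ := exists_truncation_bound hV.truncation (u' i) (v' i) j
  refine (Set.finite_Iio M).subset fun l hl => ?_
  by_contra h'
  exact hl (by simp [hM l (by simpa using h')])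

theorem oppositeY_truncation (hV : IsWeakQuantumVertexAlgebra Y one)
    (hA : ∀ u v, ∃ k, IsAssocAt Y Y u v k) (u v : V) :
    IsLaurent fun n => oppositeY Y one hV.truncation u n v := by
  obtain ⟨N, hN⟩ := hV.truncation v u
  refine ⟨N, fun n hn => ?_⟩
  have := oppositeY_apply_eq_sum hV hA (M := 0) (u := u) (v := v) (n := n)
    fun i _ => hN _ (by omega)
  simpa using this

theorem oppositeY_one (hV : IsWeakQuantumVertexAlgebra Y one)
    (hA : ∀ u v, ∃ k, IsAssocAt Y Y u v k) :
    oppositeY Y one hV.truncation one = Pi.single 0 1 := by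
  ext n v
  rw [oppositeY_apply_eq_sum hV hA (M := (n + 1).toNat) fun i hi => hV.creation _ _ (by omega)]
  -- This is exp(x𝒟) exp(-x𝒟)v = v: the scalars sum by Vandermonde to `ch (n - 1) n`, which is zero
  -- unless n = 0.
  have h : ∀ i ∈ Finset.range (n + 1).toNat, (-1 : ℂ) ^ (n - i) • Y (Y v (n - i) one) i one =
      (ch n i * ch (-1) (n - i)) • Y v n one := fun i hi => by
    rw [Finset.mem_range] at hi
    obtain ⟨l, hl⟩ := Int.eq_ofNat_of_zero_le (a := n - i) (by omega)
    rw [hl, apply_one_apply hV hA, smul_smul, show (i : ℤ) + l = n by omega, mul_comm (ch n i),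
      ch_neg (-1), ← ch_symm (n := l - -1 - 1) (by omega), ← ch_symm (n := n) (by omega) i, hl]
    simp
  rw [Finset.sum_congr rfl h, ← Finset.sum_smul, sum_range_ch_mul_ch _ _ _ (by omega)]
  rcases lt_trichotomy n 0 with hn | rfl | hn
  · rw [ch_of_neg _ hn, zero_smul, Pi.single_eq_of_ne hn.ne]; rfl
  · simp [hV.creation_limit]
  · rw [ch_eq_zero_of_lt (by omega) (by omega), zero_smul, Pi.single_eq_of_ne hn.ne']; rfl

theorem oppositeY_apply_one (hV : IsWeakQuantumVertexAlgebra Y one)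
    (hA : ∀ u v, ∃ k, IsAssocAt Y Y u v k) (u : V) (n : ℤ) :
    oppositeY Y one hV.truncation u n one = Y u n one := by
  rw [oppositeY_apply hV hA, hV.vacuum]
  rcases lt_or_ge n 0 with hn | hn
  · rw [hV.creation u n hn]
    refine finsum_eq_zero_of_forall_eq_zero fun i => ?_
    rw [Pi.single_eq_of_ne (by omega)]
    simp
  · lift n to ℕ using hn
    rw [finsum_eq_single _ n]
    · simp
    · intro i hi
      rw [Pi.single_eq_of_ne (by omega)]
      simp

/-- The iterate `Yᵒ(u, x₁) Yᵒ(v, x₂) w` is `exp(x₁ 𝒟)` applied to a series that is expanded from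
`Y(w, y₁) Y(v, y₂) u` at `y₁ = -x₁`, `y₂ = x₂ - x₁`. -/
theorem prodCoeff_oppositeY (hV : IsWeakQuantumVertexAlgebra Y one)
    (hA : ∀ u v, ∃ k, IsAssocAt Y Y u v k) {u v w : V} {k : ℕ} (h : IsAssocAt Y Y w v k)
    (m n : ℤ) : prodCoeff (oppositeY Y one hV.truncation) u v w m n =
      ∑ᶠ s : ℕ, Y (reflectCoeff k (mulPow k (prodCoeff Y w v u)) (m - s) n) s one := by
  rw [prodCoeff, oppositeY_apply hV hA]
  refine finsum_congr fun s => ?_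
  rw [reflectCoeff, h.taylorCoeff_swap hV hA (apply_one_apply hV hA), add_sub_cancel_right,
    smul_smul, neg_one_zpow_add, mul_assoc, zpow_natCast, ← mul_pow]
  simp

theorem mulPow_prodCoeff_oppositeY (hV : IsWeakQuantumVertexAlgebra Y one)
    (hA : ∀ u v, ∃ k, IsAssocAt Y Y u v k) {u v w : V} {k : ℕ} (h : IsAssocAt Y Y w v k)
    (l : ℕ) (m n : ℤ) : mulPow l (prodCoeff (oppositeY Y one hV.truncation) u v w) m n =
      ∑ᶠ s : ℕ, Y (mulPow l (reflectCoeff k (mulPow k (prodCoeff Y w v u))) (m - s) n) s one := by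
  obtain ⟨N, hN⟩ := (h u).1
  simp only [mulPow_natCast l, prodCoeff_oppositeY hV hA h, map_sum, Finset.sum_apply,
    LinearMap.sum_apply, map_smul, Pi.smul_apply, LinearMap.smul_apply, smul_finsum]
  rw [← finsum_sum_comm]
  · simp only [sub_right_comm]
  · intro i _
    refine (Set.finite_Iio (m + n + k - 2 * N + 1).toNat).subset fun s hs => ?_
    by_contra h'
    rw [Set.mem_Iio, not_lt] at h'
    refine hs ?_
    beta_reduce
    rw [reflectCoeff_eq_zero hN k (by omega)]
    simp

/-- `(x₂ - x₁) ^ l * Yᵒ(u, x₁) Yᵒ(v, x₂) w` becomes `z ^ l * Yᵒ(Y(v, z) u, x₁) w` at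
`x₂ = x₁ + z`. -/
theorem exists_assoc_oppositeY (hV : IsWeakQuantumVertexAlgebra Y one)
    (hA : ∀ u v, ∃ k, IsAssocAt Y Y u v k) (u v : V) : ∃ l : ℕ, ∀ w : V,
      IsLaurent₂ (mulPow l (prodCoeff (oppositeY Y one hV.truncation) u v w)) ∧ ∀ j c : ℤ,
        taylorCoeff
            (fun m n => mulPow l (prodCoeff (oppositeY Y one hV.truncation) u v w) n m) j c =
          (-1 : ℂ) ^ l • oppositeY Y one hV.truncation (Y v (j - l) u) c w := by
  -- The exponent l comes from the pole of Y(v, x)u and is fixed before w; the exponent k below may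
  -- depend on w.
  obtain ⟨N₀, hN₀⟩ := hV.truncation v u
  refine ⟨(-N₀).toNat, fun w => ?_⟩
  obtain ⟨l, hl⟩ : ∃ l, l = (-N₀).toNat := ⟨_, rfl⟩
  rw [← hl]
  obtain ⟨k, hk⟩ := hA w v
  obtain ⟨N, hN⟩ := (hk u).1
  have hq : ∀ p q : ℤ, q < -l → mulPow k (prodCoeff Y w v u) p q = 0 := fun p q h => by
    rw [mulPow_natCast]
    refine Finset.sum_eq_zero fun i _ => ?_
    have : Y v (q - i) u = 0 := hN₀ _ (by omega)
    rw [prodCoeff, this, map_zero, smul_zero]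
  have hP := isDiagTruncated_prodCoeff hV.truncation w v u
  have hG := isLaurent₂_mulPow_reflectCoeff hN hq k
  have hT := taylorCoeff_mulPow_reflectCoeff hN hq hP rfl
  have hE := mulPow_prodCoeff_oppositeY hV hA (u := u) hk l
  generalize mulPow l (reflectCoeff k (mulPow k (prodCoeff Y w v u))) = G at hG hT hE
  obtain ⟨N', hN'⟩ := id hG
  have hL : ∀ m n : ℤ, (m < N' ∨ n < N') →
      mulPow l (prodCoeff (oppositeY Y one hV.truncation) u v w) m n = 0 := fun m n h => by
    rw [hE]
    refine finsum_eq_zero_of_forall_eq_zero fun s => ?_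
    rw [hN' _ _ (by omega)]
    simp
  refine ⟨⟨N', hL⟩, fun j c => ?_⟩
  rw [taylorCoeff_eq_sum (fun m n h => hL n m h.symm) rfl, oppositeY_apply hV hA, smul_finsum]
  have hE' : ∀ n, mulPow l (prodCoeff (oppositeY Y one hV.truncation) u v w) (c + j - n) n =
      ∑ᶠ s : ℕ, Y (G (c + j - s - n) n) s one := fun n => by
    rw [hE]
    simp only [sub_right_comm]
  simp only [hE', smul_finsum]
  rw [← finsum_sum_comm]
  · refine finsum_congr fun s => ?_
    have h1 := hT j (c - s)
    rw [taylorCoeff, finsum_int_eq_sum _ N' (c + j - N') fun n hn => by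
      rw [hN' _ _ (by omega), smul_zero]] at h1
    have h2 := congrArg (fun a => Y a s one) h1
    simp only [map_sum, Finset.sum_apply, LinearMap.sum_apply, map_smul, Pi.smul_apply,
      LinearMap.smul_apply, prodCoeff] at h2
    rw [smul_smul, ← zpow_natCast, ← neg_one_zpow_add, ← h2, sub_add_eq_add_sub]
  · intro n _
    refine (Set.finite_Iio (c + j - 2 * N' + 1).toNat).subset fun s hs => ?_
    by_contra h'
    rw [Set.mem_Iio, not_lt] at h'
    refine hs ?_
    beta_reduce
    rw [hN' _ _ (by omega)]
    simp

end Opposite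

/-! ### Associativity and the Jacobi identity for the opposite algebra -/

section OppositeJacobi

variable {V : Type*} [AddCommGroup V] [Module ℂ V] {Y : V →ₗ[ℂ] (ℤ → Module.End ℂ V)} {one : V}

/-- The case u = 𝟏 of `exists_assoc_oppositeY`, where the product is a series in one variable. -/
theorem oppositeY_apply_one_apply (hV : IsWeakQuantumVertexAlgebra Y one)
    (hA : ∀ u v, ∃ k, IsAssocAt Y Y u v k) (b : V) (l : ℕ) (c : ℤ) (w : V) :
    oppositeY Y one hV.truncation (Y b l one) c w =
      ch (c + l) l • oppositeY Y one hV.truncation b (c + l) w := by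
  obtain ⟨k, hk⟩ := exists_assoc_oppositeY hV hA one b
  have h1 := (hk w).2 (l + k) c
  have h2 : (fun m n => prodCoeff (oppositeY Y one hV.truncation) one b w n m) =
      fun m n => if n = 0 then oppositeY Y one hV.truncation b m w else 0 := by
    ext m n
    rw [prodCoeff, oppositeY_one hV hA]
    split_ifs with hn
    · simp [hn]
    · simp [Pi.single_eq_of_ne hn]
  have h3 : (fun m n => mulPow k (prodCoeff (oppositeY Y one hV.truncation) one b w) n m) =
      fun m n => (-1 : ℂ) ^ k • mulPow k
        (fun m n => if n = 0 then oppositeY Y one hV.truncation b m w else 0) m n := by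
    ext m n
    rw [← h2]
    exact mulPow_swap k _ n m
  rw [h3, taylorCoeff_smul, taylorCoeff_mulPow_const (oppositeY_truncation hV hA b w),
    add_sub_cancel_right, ← add_assoc, add_sub_cancel_right] at h1
  exact (smul_right_injective V (pow_ne_zero k (by norm_num : (-1 : ℂ) ≠ 0)) h1).symm

/-- Exchanging the variables in `exists_assoc_oppositeY` turns Y(v, z)u into Yᵒ(u, z)v; the
translation rule for Yᵒ supplies the binomials. -/
theorem exists_isAssocAt_oppositeY (hV : IsWeakQuantumVertexAlgebra Y one)
    (hA : ∀ u v, ∃ k, IsAssocAt Y Y u v k) (u v : V) :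
    ∃ k, IsAssocAt (oppositeY Y one hV.truncation) (oppositeY Y one hV.truncation) u v k := by
  obtain ⟨k, hk⟩ := exists_assoc_oppositeY hV hA u v
  refine ⟨k, fun w => ⟨(hk w).1, fun j c => ?_⟩⟩
  rw [apply_oppositeY hV hA (oppositeY_apply_one_apply hV hA)]
  refine (taylorCoeff_swap (hk w).1.swap j c).trans (finsum_congr fun l => ?_)
  rw [(hk w).2, smul_smul, mul_right_comm, ← zpow_natCast, ← neg_one_zpow_add,
    show j - l - k = j - k - l by ring,
    neg_one_zpow_eq (m := j - l + k) (n := j - k - l) ⟨k, by ring⟩]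

/-- Unlike `exists_assoc_oppositeY`, this holds at every exponent at which associativity holds,
hence at an exponent common to several pairs. -/
theorem taylorCoeff_swap_oppositeY (hV : IsWeakQuantumVertexAlgebra Y one)
    (hA : ∀ u v, ∃ k, IsAssocAt Y Y u v k) {u v : V} {k : ℕ}
    (h : IsAssocAt (oppositeY Y one hV.truncation) (oppositeY Y one hV.truncation) u v k)
    (w : V) (j c : ℤ) :
    taylorCoeff (fun m n => mulPow k (prodCoeff (oppositeY Y one hV.truncation) u v w) n m) j c =
      (-1 : ℂ) ^ k • oppositeY Y one hV.truncation (Y v (j - k) u) c w := by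
  obtain ⟨M, hM⟩ := exists_truncation_bound (oppositeY_truncation hV hA) u v (j - k)
  rw [taylorCoeff_swap (h w).1, ← finsum_oppositeY hV hA,
    finsum_nat_eq_sum _ M fun i hi => by
      rw [(h w).2, sub_right_comm, hM i hi]; simp,
    finsum_nat_eq_sum _ M fun i hi => by simp [hM i hi]]
  simp only [map_sum, Finset.sum_apply, LinearMap.sum_apply, map_smul, Pi.smul_apply,
      LinearMap.smul_apply, oppositeY_apply_one_apply hV hA, Finset.smul_sum, (h w).2]
  refine Finset.sum_congr rfl fun l _ => ?_
  rw [smul_smul, smul_smul, ← zpow_natCast, ← neg_one_zpow_add,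
    show j - l - k = j - k - l by ring,
    neg_one_zpow_eq (m := k + (j - k - l)) (n := j - l) ⟨0, by ring⟩]

theorem isWeakQuantumVertexAlgebra_oppositeY (hV : IsWeakQuantumVertexAlgebra Y one)
    (hS : HasConstantS Y) :
    IsWeakQuantumVertexAlgebra (oppositeY Y one hV.truncation) one := by
  have hA := exists_isAssocAt_self hV hS
  have hT := oppositeY_truncation hV hA
  refine ⟨hT, oppositeY_one hV hA, fun u n hn => ?_, fun u => ?_, fun u v => ?_⟩
  · rw [oppositeY_apply_one hV hA, hV.creation u n hn]
  · rw [oppositeY_apply_one hV hA, hV.creation_limit]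
  · obtain ⟨S, hS⟩ := hS
    -- The order is reversed: the exchanged expansion for Yᵒ at (u, v) involves Y(v, z)u, which skew
    -- symmetry at (v, u) rewrites through Yᵒ.
    obtain ⟨r, v', u', -, h⟩ := hS v u
    obtain ⟨k, hk, hk'⟩ :=
      exists_common_isAssocAt hT (exists_isAssocAt_oppositeY hV hA) u v u' v'
    refine ⟨r, u', v', fun _ => 1, sJacobi_of_isAssocAt hT hk fun w =>
      mulPow_prodCoeff_eq_of_skew hk hk' w fun j c => ?_⟩
    rw [taylorCoeff_swap_oppositeY hV hA hk, eq_sum_oppositeY_of_sJacobi hV hA h]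

end OppositeJacobi

/-! ### The dual module -/

section Dual

variable {V : Type*} [AddCommGroup V] [Module ℂ V] {Y : V →ₗ[ℂ] (ℤ → Module.End ℂ V)} {one : V}
  {W : Type*} [AddCommGroup W] [Module ℂ W] {YW : V →ₗ[ℂ] (ℤ → Module.End ℂ W)}

theorem dualY_apply (v : V) (n : ℤ) (α : Module.Dual ℂ W) (w : W) :
    dualY YW v n α w = α (YW v (-n) w) := rfl

theorem IsModule.apply_one_apply (hW : IsModule Y one YW) (a : V) (l : ℕ) (c : ℤ) (w : W) :
    YW (Y a l one) c w = ch (c + l) l • YW a (c + l) w := by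
  obtain ⟨k, hk⟩ := hW.exists_isAssocAt a one
  exact hk.apply_one hW.truncation hW.vacuum _ _ _

theorem exists_bound_of_mem_dualSpace {α : Module.Dual ℂ W} (hα : α ∈ dualSpace YW) (v : V) :
    ∃ N : ℤ, ∀ n, N < n → ∀ w, α (YW v n w) = 0 := by
  obtain ⟨N, hN⟩ := hα v
  refine ⟨-N, fun n hn w => ?_⟩
  have := LinearMap.congr_fun (hN (-n) (by omega)) w
  rwa [dualY_apply, neg_neg] at this

/-- Commutativity on `W` bounds the powers in `⟨α, (x₁ - x₂)ᵏ Y_W(u, x₁) Y_W(v, x₂) w⟩` above,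
uniformly in `w`. -/
theorem exists_bound_mulPow_prodCoeff (hV : IsWeakQuantumVertexAlgebra Y one)
    (hS : HasConstantS Y) (hW : IsModule Y one YW) (u v : V) :
    ∃ k : ℕ, IsAssocAt Y YW u v k ∧ ∀ α ∈ dualSpace YW, ∃ N : ℤ, ∀ (w : W) (p q : ℤ),
      (N < p ∨ N < q) → α (mulPow k (prodCoeff YW u v w) p q) = 0 := by
  have hA := exists_isAssocAt_self hV hS
  obtain ⟨S, hS⟩ := hS
  obtain ⟨r, u', v', -, h⟩ := hS u v
  obtain ⟨k, hk, hk'⟩ :=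
    exists_common_isAssocAt hW.truncation hW.exists_isAssocAt u v u' v'
  have hcomm : ∀ w p q, mulPow k (prodCoeff YW u v w) p q =
      (-1 : ℂ) ^ k • ∑ i, mulPow k (prodCoeff YW (v' i) (u' i) w) q p := fun w =>
    mulPow_prodCoeff_eq_of_skew hk hk' w fun j c => by
      rw [hk.taylorCoeff_swap hV hA hW.apply_one_apply, oppositeY_eq_sum_of_sJacobi hV hA h]
  refine ⟨k, hk, fun α hα => ?_⟩
  -- As α lies in D(W), the leftmost operator has powers bounded above under α, whatever vector it
  -- acts on. Commutativity puts each variable on the left in turn.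
  have hbound : ∀ a b : V, ∃ N : ℤ, ∀ (w : W) (p q : ℤ), N < p →
      α (mulPow k (prodCoeff YW a b w) p q) = 0 := fun a b => by
    obtain ⟨N, hN⟩ := exists_bound_of_mem_dualSpace hα a
    refine ⟨N + k, fun w p q hp => ?_⟩
    rw [mulPow_natCast, map_sum]
    refine Finset.sum_eq_zero fun i _ => ?_
    rw [prodCoeff, map_smul, hN _ (by omega), smul_zero]
  obtain ⟨N, hN⟩ := hbound u v
  choose N' hN' using fun i => hbound (v' i) (u' i)
  obtain ⟨M, hM⟩ := (Set.finite_range N').bddAbove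
  refine ⟨max N M, fun w p q hpq => ?_⟩
  simp only [max_lt_iff] at hpq
  rcases hpq with hp | hq
  · exact hN w p q hp.1
  · rw [hcomm, map_smul, map_sum, Finset.sum_eq_zero, smul_zero]
    intro i _
    exact hN' i w q p ((hM (Set.mem_range_self i)).trans_lt hq.2)

/-- The pairing is (x₁ - x₂)⁻ᵏ times a series with both powers bounded above; for a fixed power of
x₁, only boundedly many terms of the expansion reach it. -/
theorem dualY_mem_dualSpace (hV : IsWeakQuantumVertexAlgebra Y one)
    (hS : HasConstantS Y) (hW : IsModule Y one YW) (v : V) (n : ℤ) (α : Module.Dual ℂ W)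
    (hα : α ∈ dualSpace YW) : dualY YW v n α ∈ dualSpace YW := by
  intro u
  obtain ⟨k, -, hk⟩ := exists_bound_mulPow_prodCoeff hV hS hW v u
  obtain ⟨N, hN⟩ := hk α hα
  -- A nonzero i-th term needs i ≤ N + n - k and -m - i ≤ N, hence -m ≤ N + |N + n - k|.
  refine ⟨-(N + |N + n - k|), fun m hm => LinearMap.ext fun w => ?_⟩
  rw [dualY_apply, dualY_apply, LinearMap.zero_apply]
  change α (prodCoeff YW v u w (-n) (-m)) = 0
  have hP := isDiagTruncated_prodCoeff hW.truncation v u w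
  have h1 : prodCoeff YW v u w = mulPow (-k) (mulPow k (prodCoeff YW v u w)) := by
    rw [mulPow_mulPow hP, neg_add_cancel, mulPow_zero]
  obtain ⟨M, hM⟩ := (hP.mulPow k).exists_bound (-n + k + -m) (-m)
  have h2 : ∀ i : ℤ, M ≤ i → mulPow k (prodCoeff YW v u w) (-n - -k + i) (-m - i) = 0 :=
    fun i hi => by rw [← hM i hi]; congr 1; ring
  rw [h1, mulPow_eq_sum h2, map_sum]
  refine Finset.sum_eq_zero fun i _ => ?_
  have := le_abs_self (N + n - k)
  have := abs_nonneg (N + n - k)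
  rw [map_smul, hN w _ _ (by omega), smul_zero]

/-- Transposition reverses the product, and (x₁ - x₂)ᵏ = (x₁x₂)ᵏ (x₂⁻¹ - x₁⁻¹)ᵏ explains the shifts
by k. -/
theorem mulPowCoeff_restrictY_dualY
    (h : ∀ (v : V) (n : ℤ), ∀ α ∈ dualSpace YW, dualY YW v n α ∈ dualSpace YW) (k : ℕ) (u v : V)
    (α : dualSpace YW) (m n : ℤ) (w : W) :
    (mulPowCoeff (restrictY (dualY YW) (dualSpace YW) h) k u v α m n).1 w =
      α.1 (mulPow k (prodCoeff YW v u w) (k - n) (k - m)) := by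
  rw [mulPowCoeff, mulPow_natCast, map_sum, Submodule.coe_sum, LinearMap.sum_apply]
  refine Finset.sum_congr rfl fun i _ => ?_
  rw [map_smul, prodCoeff, show k - n - (k - i) = -(n - i) by ring,
    show k - m - i = -(m - (k - i)) by ring]
  rfl

theorem isPhiCoordinatedModule_dual (hV : IsWeakQuantumVertexAlgebra Y one)
    (hS : HasConstantS Y) (hW : IsModule Y one YW)
    (h : ∀ (v : V) (n : ℤ), ∀ α ∈ dualSpace YW, dualY YW v n α ∈ dualSpace YW) :
    IsPhiCoordinatedModule phiStar (oppositeY Y one hV.truncation) one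
      (restrictY (dualY YW) (dualSpace YW) h) := by
  have hA := exists_isAssocAt_self hV hS
  refine ⟨fun v α => ?_, ?_, fun u v => ?_⟩
  · obtain ⟨N, hN⟩ := α.2 v
    exact ⟨N, fun n hn => Subtype.ext (hN n hn)⟩
  · ext n α w
    change α.1 (YW one (-n) w) = _
    rw [hW.vacuum]
    rcases eq_or_ne n 0 with rfl | hn
    · simp
    · rw [Pi.single_eq_of_ne (by omega), Pi.single_eq_of_ne hn]
      simp
  · obtain ⟨k, hk, hbound⟩ := exists_bound_mulPow_prodCoeff hV hS hW v u
    have hL : ∀ α, IsLaurent₂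
        (mulPowCoeff (restrictY (dualY YW) (dualSpace YW) h) k u v α) := fun α => by
      obtain ⟨N, hN⟩ := hbound α α.2
      refine ⟨k - N, fun m n hmn => Subtype.ext (LinearMap.ext fun w => ?_)⟩
      rw [mulPowCoeff_restrictY_dualY, hN w _ _ (by omega)]
      rfl
    refine ⟨k, hL, fun α j c => Subtype.ext (LinearMap.ext fun w => ?_)⟩
    obtain ⟨N, hN⟩ := (hk w).1
    have hR := hk.taylorCoeff_swap hV hA hW.apply_one_apply w
    obtain ⟨M, hM⟩ := exists_truncation_bound (oppositeY_truncation hV hA) u v (j - k)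
    -- After pairing with w, the lower bounds for the series on W make the sum finite; the index p =
    -- k - m is the power of x₁⁻¹.
    have hleft : (substCoeff phiStar (mulPowCoeff (restrictY (dualY YW) (dualSpace YW) h) k u v α)
        j c).1 w = ∑ p ∈ Finset.Icc N (2 * k - c + j - N), ch (p - k) j •
          α.1 (mulPow k (prodCoeff YW v u w) (2 * k - c + j - p) p) := by
      rw [substCoeff_phiStar]
      change (LinearMap.applyₗ w ∘ₗ (dualSpace YW).subtype) _ = _
      rw [map_finsum _ ((hL α).finite_line (c - j) fun m => ch (-m) j),
        ← finsum_comp_equiv (Equiv.subLeft (k : ℤ)), finsum_int_eq_sum _ N (2 * k - c + j - N)]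
      · refine Finset.sum_congr rfl fun p _ => ?_
        rw [map_smul, Equiv.subLeft_apply, neg_sub]
        congr 1
        refine (mulPowCoeff_restrictY_dualY h k u v α _ _ w).trans ?_
        rw [sub_sub_cancel, show k - (c - j - (k - p)) = 2 * k - c + j - p by ring]
      · intro p hp
        rw [map_smul, Equiv.subLeft_apply]
        refine smul_eq_zero_of_right _ ((mulPowCoeff_restrictY_dualY h k u v α _ _ w).trans ?_)
        rw [hN _ _ (by omega), map_zero]
    have hterm : ∀ i : ℕ, ((-1 : ℂ) ^ k * ch (-k) i) •
        α.1 (YW (oppositeY Y one hV.truncation u (j - k - i) v) (-(c - 2 * k - i)) w) =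
        ∑ p ∈ Finset.Icc N (2 * k - c + j - N), (ch (-k) i * ch p (j - i)) •
          α.1 (mulPow k (prodCoeff YW v u w) (2 * k - c + j - p) p) := fun i => by
      have := hR (j - i) (2 * k + i - c)
      rw [taylorCoeff_eq_sum (fun m n h => hN n m h.symm)
        (show 2 * k + i - c + (j - i) = 2 * k - c + j by ring)] at this
      rw [mul_comm, mul_smul, ← map_smul, show -(c - 2 * k - i) = 2 * k + i - c by ring,
        show j - k - i = j - i - k by ring, ← this, map_sum, Finset.smul_sum]
      exact Finset.sum_congr rfl fun p _ => by rw [map_smul, smul_smul]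
    -- The cutoff exceeds both the range where Yᵒ(u, z)v contributes and the index j needed for
    -- Vandermonde, which combines (1 + zx)⁻ᵏ with the binomials of the swapped expansion.
    rw [hleft, iterateCoeff_phiStar, finsum_nat_eq_sum _ (max M (j + 1).toNat) fun i hi => by
      rw [hM i ((le_max_left _ _).trans hi)]; simp]
    rw [Submodule.coe_sum, LinearMap.sum_apply]
    refine Eq.trans ?_ (Finset.sum_congr rfl fun i _ => (hterm i).symm)
    rw [Finset.sum_comm]
    refine Finset.sum_congr rfl fun p _ => ?_
    rw [← Finset.sum_smul, sum_range_ch_mul_ch _ _ _ (by omega), neg_add_eq_sub]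

end Dual

end WQVA

end

theorem theorem3p6 {V : Type*} [AddCommGroup V] [Module ℂ V] {W : Type*} [AddCommGroup W]
    [Module ℂ W] (Y : V →ₗ[ℂ] (ℤ → Module.End ℂ V)) (one : V)
    (hV : WQVA.IsWeakQuantumVertexAlgebra Y one) (hS : WQVA.HasConstantS Y)
    (YW : V →ₗ[ℂ] (ℤ → Module.End ℂ W)) (hW : WQVA.IsModule Y one YW) :
    (∀ (v : V), ∀ α ∈ WQVA.dualSpace YW,
      (∀ n : ℤ, WQVA.dualY YW v n α ∈ WQVA.dualSpace YW) ∧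
        WQVA.IsLaurent fun n => WQVA.dualY YW v n α) ∧
    WQVA.IsWeakQuantumVertexAlgebra (WQVA.oppositeY Y one hV.truncation) one ∧
    ∃ h : ∀ (v : V) (n : ℤ), ∀ α ∈ WQVA.dualSpace YW, WQVA.dualY YW v n α ∈ WQVA.dualSpace YW,
      WQVA.IsPhiCoordinatedModule WQVA.phiStar (WQVA.oppositeY Y one hV.truncation) one
        (WQVA.restrictY (WQVA.dualY YW) (WQVA.dualSpace YW) h) := by
  have h := WQVA.dualY_mem_dualSpace hV hS hW
  exact ⟨fun v α hα => ⟨fun n => h v n α hα, hα v⟩,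
    WQVA.isWeakQuantumVertexAlgebra_oppositeY hV hS, h,
    WQVA.isPhiCoordinatedModule_dual hV hS hW h⟩
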